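/- Let $P\subseteq\mathbb{R}^n$ be a $(0,k)$-lattice polytope of dimension $d$, i.e. the convex hull of a nonempty finite set of integer points of $[0,k]^n$. The graph of $P$ has the vertices of $P$ as nodes and the edges of $P$ as edges. (a) Let $P=\{x: Ax\le b\}$ with real $A\in\mathbb{R}^{m\times n}$ and $b\in\mathbb{R}^m$, let $c\in\mathbb{R}^n$, and let any feasible basis $B_0$ of $Ax\le b$ be given ($n$ linearly independent rows whose solution as equations, the basic solution, lies in $P$). The following algorithm solves $\max(c^{\intercal}x : x\in P)$ by running the Simplex method, with prescribed pivot rules, on $2n$ LPs over faces of $P$. Each LP is started at the final basis of the LP before it, and the first one at $B_0$. * LPs $0,\dots,n-1$: put $F_0=P$. For $q<n$ let $v$ be the current basic solution and let $j$ be the coordinate, among those not chosen before, for which $v_j$ is closest to $0$ or $k$ (the first one in case of ties). Put $w_q=e_j$ if $k-v_j\le v_j$, and $w_q=-e_j$ otherwise. Solve $\max(w_q^{\intercal}x: x\in F_q)$ by the Simplex method with Bland's pivot rule, and let $F_{q+1}$ be the set of maximizers. A face $F_q$ is given to the Simplex method by turning inequalities of $Ax\le b$ into equations, which then stay in the basis: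 none for $F_0$, and in passing from $F_q$ to $F_{q+1}$ those inequalities of the optimal basis found that have negative reduced cost for $w_q$ are added. (The reduced cost of a basis inequality is the rate of change of the objective when this inequality is relaxed, the others of the basis being kept as equations.) * LPs $n,\dots,2n-1$: for $q=n-1,n-2,\dots,0$, in this order, solve $\max(c^{\intercal}x:x\in F_q)$ by the Simplex method with the shadow pivot rule with auxiliary vector $a=-w_q$: among the directions $u$ obtained by relaxing one basis inequality that is not an equation of $F_q$, and with $a^{\intercal}u>0$, take one that maximizes $c^{\intercal}u/a^{\intercal}u$ (ties: least index of the relaxed inequality), and choose the inequality that enters the basis by the lexicographic ratio test with respect to the starting basis of this LP. For every such $A,b,c,B_0$ this algorithm terminates, each LP in the sequence is over a face of $P$ and is solved to optimality, and the final basic solution is a maximizer of $c^{\intercal}x$ over $P$. The total number of non-degenerate steps (pivots that change the basic solution), over all $2n$ LPs, is at most $d\left(k+\lfloor k/2\rfloor\right)$. The sequence of basic solutions met, without immediate repetitions, is a walk along edges in the graph of $P$ from the basic solution of $B_0$ to the final one, and its length is the number of non-degenerate steps. (b) The algorithm yields a constructive diameter bound: if $P=\{x:Ax\le b\}$, then for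 any two vertices $u,v$ of $P$ there are an objective $c$ and a feasible basis $B_0$ with basic solution $u$ for which the algorithm ends at $v$. The diameter of the graph of $P$ is at most $d\left(k+\lfloor k/2\rfloor\right)$. -/

import Mathlib

open scoped Matrix

noncomputable section

/-! ### Lattice polytopes, their graphs and their faces -/

/-- `P ⊆ ℝⁿ` is a `(0,k)`-lattice polytope: the convex hull of a nonempty finite set of integer
points of the cube `[0,k]ⁿ`. -/
def IsZeroKLatticePolytope {n : ℕ} (k : ℕ) (P : Set (Fin n → ℝ)) : Prop :=
  ∃ S : Finset (Fin n → ℤ), S.Nonempty ∧ (∀ z ∈ S, ∀ j, 0 ≤ z j ∧ z j ≤ (k : ℤ)) ∧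
    P = convexHull ℝ ((fun (z : Fin n → ℤ) (j : Fin n) => (z j : ℝ)) '' (S : Set (Fin n → ℤ)))

/-- The graph of a polytope `P`: its nodes are the vertices (extreme points) of `P`, and two
different vertices are adjacent when the segment between them is a face of `P`. -/
def polytopeGraph {n : ℕ} (P : Set (Fin n → ℝ)) : SimpleGraph (P.extremePoints ℝ) where
  Adj u v := u ≠ v ∧ IsExposed ℝ P (segment ℝ (u : Fin n → ℝ) v)
  symm := ⟨fun u v h => ⟨h.1.symm, by rw [segment_symm]; exact h.2⟩⟩
  loopless := ⟨fun _ h => h.1 rfl⟩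

/-- The polyhedron `{x : A x ≤ b}`. -/
def polyhedron {m n : ℕ} (A : Matrix (Fin m) (Fin n) ℝ) (b : Fin m → ℝ) : Set (Fin n → ℝ) :=
  {x | ∀ r, A r ⬝ᵥ x ≤ b r}

/-- The face of `{x : A x ≤ b}` on which the inequalities with index in `E` are equalities. -/
def faceOf {m n : ℕ} (A : Matrix (Fin m) (Fin n) ℝ) (b : Fin m → ℝ) (E : Finset (Fin m)) :
    Set (Fin n → ℝ) :=
  {x | x ∈ polyhedron A b ∧ ∀ r ∈ E, A r ⬝ᵥ x = b r}

/-- The set of maximizers over `F` of the linear function with coefficient vector `w`. -/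
def maximizers {n : ℕ} (F : Set (Fin n → ℝ)) (w : Fin n → ℝ) : Set (Fin n → ℝ) :=
  {x | x ∈ F ∧ ∀ y ∈ F, w ⬝ᵥ y ≤ w ⬝ᵥ x}

/-! ### The Simplex method on the face `faceOf A b E`

A basis is listed as `B : Fin n → Fin m`: the `n` inequalities `B 0, …, B (n-1)` (the nonbasic
slack variables) are set to equality.  In an LP over `faceOf A b E` the inequalities in `E` are
equations, and so stay in the basis throughout. -/

/-- The solution of the `n` equations `A_{B i} x = b_{B i}`. -/
def basicSol {m n : ℕ} (A : Matrix (Fin m) (Fin n) ℝ) (b : Fin m → ℝ) (B : Fin n → Fin m) :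
    Fin n → ℝ :=
  (A.submatrix B id)⁻¹ *ᵥ (fun i => b (B i))

/-- `B` is a feasible basis of `A x ≤ b`: its rows are linearly independent and the basic
solution is feasible. -/
def IsFeasibleBasis {m n : ℕ} (A : Matrix (Fin m) (Fin n) ℝ) (b : Fin m → ℝ)
    (B : Fin n → Fin m) : Prop :=
  IsUnit (A.submatrix B id).det ∧ basicSol A b B ∈ polyhedron A b

/-- The direction obtained by relaxing the `i`-th inequality of the basis: it satisfies
`A_{B i} · u = -1` and `A_{B l} · u = 0` for `l ≠ i`.  For an objective `w`, the number
`w ⬝ᵥ edgeDir A B i` is the reduced cost of the slack variable of the inequality `B i`. -/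
def edgeDir {m n : ℕ} (A : Matrix (Fin m) (Fin n) ℝ) (B : Fin n → Fin m) (i : Fin n) :
    Fin n → ℝ :=
  fun j => -(A.submatrix B id)⁻¹ j i

/-- The optimality test of the Simplex method for `max w·x` over `faceOf A b E`: no
reduced cost is positive. -/
def IsOptimalBasis {m n : ℕ} (A : Matrix (Fin m) (Fin n) ℝ) (E : Finset (Fin m))
    (w : Fin n → ℝ) (B : Fin n → Fin m) : Prop :=
  ∀ i, B i ∉ E → w ⬝ᵥ edgeDir A B i ≤ 0

/-- Inequality `s` blocks the direction `edgeDir A B i`. -/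
def Blocks {m n : ℕ} (A : Matrix (Fin m) (Fin n) ℝ) (B : Fin n → Fin m) (i : Fin n)
    (s : Fin m) : Prop :=
  0 < A s ⬝ᵥ edgeDir A B i

/-- The step length at which inequality `s` becomes tight along `edgeDir A B i`. -/
def stepRatio {m n : ℕ} (A : Matrix (Fin m) (Fin n) ℝ) (b : Fin m → ℝ) (B : Fin n → Fin m)
    (i : Fin n) (s : Fin m) : ℝ :=
  (b s - A s ⬝ᵥ basicSol A b B) / (A s ⬝ᵥ edgeDir A B i)

/-- A pivot of the Simplex method for `max w·x` over `faceOf A b E`: an inequality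
`B i ∉ E` of positive reduced cost is exchanged for an inequality `s` that attains the minimum in
the ratio test.  The new basis is `Function.update B i s`. -/
def IsPivot {m n : ℕ} (A : Matrix (Fin m) (Fin n) ℝ) (b : Fin m → ℝ) (E : Finset (Fin m))
    (w : Fin n → ℝ) (B : Fin n → Fin m) (i : Fin n) (s : Fin m) : Prop :=
  B i ∉ E ∧ 0 < w ⬝ᵥ edgeDir A B i ∧ Blocks A B i s ∧
    ∀ s', Blocks A B i s' → stepRatio A b B i s ≤ stepRatio A b B i s'

/-- Bland's pivot rule: the eligible index `B i` is the least one, and then so is `s`. -/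
def IsBlandPivot {m n : ℕ} (A : Matrix (Fin m) (Fin n) ℝ) (b : Fin m → ℝ) (E : Finset (Fin m))
    (w : Fin n → ℝ) (B : Fin n → Fin m) (i : Fin n) (s : Fin m) : Prop :=
  IsPivot A b E w B i s ∧
    (∀ i', B i' ∉ E → 0 < w ⬝ᵥ edgeDir A B i' → B i ≤ B i') ∧
    (∀ s', IsPivot A b E w B i s' → s ≤ s')

open Classical in
/-- The row of the lexicographic ratio test that belongs to inequality `s` and basis `B`.  If the
right-hand side `b t` is replaced by `b t + ε t` for all `t` outside the basis `B₀`, then the slack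
of `s` at the basic solution of `B` is entry `0` plus the sum over `t` of `ε t` times
entry `t + 1`. -/
def lexRow {m n : ℕ} (A : Matrix (Fin m) (Fin n) ℝ) (b : Fin m → ℝ) (B₀ B : Fin n → Fin m)
    (s : Fin m) : Fin (m + 1) → ℝ :=
  Fin.cons (b s - A s ⬝ᵥ basicSol A b B) (fun t =>
    if t ∈ Set.range B₀ then 0
    else (if s = t then 1 else 0) + ∑ l, if B l = t then A s ⬝ᵥ edgeDir A B l else 0)

/-- The row of the lexicographic ratio test divided by the pivot element. -/
def lexRatio {m n : ℕ} (A : Matrix (Fin m) (Fin n) ℝ) (b : Fin m → ℝ) (B₀ B : Fin n → Fin m)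
    (i : Fin n) (s : Fin m) : Lex (Fin (m + 1) → ℝ) :=
  toLex (fun t => lexRow A b B₀ B s t / (A s ⬝ᵥ edgeDir A B i))

/-- The slope of the direction `edgeDir A B i` in the shadow for objective `w` and auxiliary
vector `a`. -/
def shadowSlope {m n : ℕ} (A : Matrix (Fin m) (Fin n) ℝ) (w a : Fin n → ℝ) (B : Fin n → Fin m)
    (i : Fin n) : ℝ :=
  (w ⬝ᵥ edgeDir A B i) / (a ⬝ᵥ edgeDir A B i)

/-- The shadow pivot rule with objective `w` and auxiliary vector `a`, for a run that was started
at the basis `B₀`: among the `a`-improving directions one of maximal slope is taken (the one of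
least index `B i` if there are several), and `s` is found by the lexicographic ratio test. -/
def IsShadowPivot {m n : ℕ} (A : Matrix (Fin m) (Fin n) ℝ) (b : Fin m → ℝ) (E : Finset (Fin m))
    (w a : Fin n → ℝ) (B₀ B : Fin n → Fin m) (i : Fin n) (s : Fin m) : Prop :=
  IsPivot A b E w B i s ∧ 0 < a ⬝ᵥ edgeDir A B i ∧
    (∀ i', B i' ∉ E → 0 < a ⬝ᵥ edgeDir A B i' →
      shadowSlope A w a B i' < shadowSlope A w a B i ∨
        (shadowSlope A w a B i' = shadowSlope A w a B i ∧ B i ≤ B i')) ∧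
    (∀ s', Blocks A B i s' → s' ≠ s → lexRatio A b B₀ B i s < lexRatio A b B₀ B i s')

/-! ### The algorithm -/

/-- A record of Simplex runs on a sequence of LPs, the `q`-th one being `max (obj q)·x` over
`faceOf A b (face q)`.  The bases met are `basis 0, basis 1, …`, and those of the `q`-th LP
are `basis (start q), …, basis (start (q + 1))`: each LP is started where the one before it
ended. -/
structure SimplexTrace (m n : ℕ) where
  face : ℕ → Finset (Fin m)
  obj : ℕ → Fin n → ℝ
  start : ℕ → ℕ
  basis : ℕ → Fin n → Fin m

/-- The distance of the `j`-th coordinate of `v ∈ [0,k]ⁿ` to `{0, k}`. -/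
def endDist {n : ℕ} (k : ℕ) (v : Fin n → ℝ) (j : Fin n) : ℝ :=
  min (v j) ((k : ℝ) - v j)

/-- `w` is the objective to be taken next at the point `v` when the coordinates `j` with `used j`
have been dealt with: `w = e_j` or `w = -e_j`, where `j` is the remaining coordinate for which `v j`
is closest to `0` or `k` (the first one if there are several), and the sign is positive if `k` is at
least as close as `0`. -/
def IsNextObjective {n : ℕ} (k : ℕ) (v : Fin n → ℝ) (used : Fin n → Prop)
    (w : Fin n → ℝ) : Prop :=
  ∃ j, ¬ used j ∧
    (∀ j', ¬ used j' → endDist k v j < endDist k v j' ∨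
      (endDist k v j = endDist k v j' ∧ j ≤ j')) ∧
    w = Pi.single j (if (k : ℝ) - v j ≤ v j then (1 : ℝ) else -1)

open Classical in
/-- The inequalities that define, within `faceOf A b E`, the face on which `w` is maximal, as read
off an optimal basis `B`: those of nonzero reduced cost are added to `E`. -/
def nextFace {m n : ℕ} (A : Matrix (Fin m) (Fin n) ℝ) (E : Finset (Fin m)) (w : Fin n → ℝ)
    (B : Fin n → Fin m) : Finset (Fin m) :=
  E ∪ (Finset.univ.filter fun i => w ⬝ᵥ edgeDir A B i < 0).image B

/-- `T` is the complete execution, from the feasible basis `B₀`, of the algorithm for `max c·x`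
over `{x : A x ≤ b} ⊆ [0,k]ⁿ`, which solves `2n` LPs by the Simplex method.
* For `q < n`, LP number `q` has an objective `obj q = ±e_j` for a new coordinate `j`
  (a coordinate is new if no earlier objective involves it) and is solved with Bland's rule; it is
  posed on the set of maximizers of the LP before it, the first one on the whole polytope.
* The LPs number `n, …, 2n-1` are posed on the same faces in reverse order, have the objective `c`,
  and are solved with the shadow pivot rule whose auxiliary vector is the negative of the former
  objective on that face. -/
structure IsExecution {m n : ℕ} (A : Matrix (Fin m) (Fin n) ℝ) (b : Fin m → ℝ) (k : ℕ)
    (c : Fin n → ℝ) (B₀ : Fin n → Fin m) (T : SimplexTrace m n) : Prop where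
  start_zero : T.start 0 = 0
  start_le : ∀ q, q < 2 * n → T.start q ≤ T.start (q + 1)
  basis_zero : T.basis 0 = B₀
  face_zero : T.face 0 = ∅
  face_succ : ∀ q, q + 1 < n →
    T.face (q + 1) = nextFace A (T.face q) (T.obj q) (T.basis (T.start (q + 1)))
  face_back : ∀ q, n ≤ q → q < 2 * n → T.face q = T.face (2 * n - 1 - q)
  obj_first : ∀ q, q < n →
    IsNextObjective k (basicSol A b (T.basis (T.start q))) (fun j => ∃ p < q, T.obj p j ≠ 0)
      (T.obj q)
  obj_back : ∀ q, n ≤ q → q < 2 * n → T.obj q = c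
  optimal : ∀ q, q < 2 * n →
    IsOptimalBasis A (T.face q) (T.obj q) (T.basis (T.start (q + 1)))
  bland : ∀ q, q < n → ∀ p, T.start q ≤ p → p < T.start (q + 1) →
    ∃ i s, IsBlandPivot A b (T.face q) (T.obj q) (T.basis p) i s ∧
      T.basis (p + 1) = Function.update (T.basis p) i s
  shadow : ∀ q, n ≤ q → q < 2 * n → ∀ p, T.start q ≤ p → p < T.start (q + 1) →
    ∃ i s, IsShadowPivot A b (T.face q) (T.obj q) (-T.obj (2 * n - 1 - q))
        (T.basis (T.start q)) (T.basis p) i s ∧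
      T.basis (p + 1) = Function.update (T.basis p) i s

namespace SimplexTrace

variable {m n : ℕ}

/-- The total number of pivots in the `2n` LPs. -/
def numPivots (T : SimplexTrace m n) : ℕ := T.start (2 * n)

open Classical in
/-- The total number of non-degenerate steps in the `2n` LPs, i.e. of the pivots that change the
basic solution. -/
def numNondegenerate (A : Matrix (Fin m) (Fin n) ℝ) (b : Fin m → ℝ) (T : SimplexTrace m n) : ℕ :=
  ((Finset.range T.numPivots).filter fun p =>
    basicSol A b (T.basis p) ≠ basicSol A b (T.basis (p + 1))).card

/-- The sequence of basic solutions met in the `2n` LPs, without immediate repetitions. -/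
def path (A : Matrix (Fin m) (Fin n) ℝ) (b : Fin m → ℝ) (T : SimplexTrace m n) :
    List (Fin n → ℝ) :=
  ((List.range (T.numPivots + 1)).map fun p => basicSol A b (T.basis p)).destutter (· ≠ ·)

/-- The point at which the last LP ends. -/
def result (A : Matrix (Fin m) (Fin n) ℝ) (b : Fin m → ℝ) (T : SimplexTrace m n) : Fin n → ℝ :=
  basicSol A b (T.basis T.numPivots)

end SimplexTrace

end

/-! ### Linear algebra of a basis -/

section BasisAlgebra

variable {m n : ℕ} {A : Matrix (Fin m) (Fin n) ℝ} {B : Fin n → Fin m}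

/-! Let F_0 ⊇ F_1 ⊇ … ⊇ F_n be the faces met in the first half, F_{q+1} being the set of maximizers
of w_q = ±e_j over F_q. The vertices of P are integral, so a non-degenerate pivot that improves ±x_j
improves it by at least 1.

In the first half the sign of w_q is chosen so that x_j is already at least halfway to its target:
LP q has at most ⌊k/2⌋ non-degenerate steps (`card_nondegenerate_first_le`). In the second half the
shadow rule improves -w_q at every pivot, so the LP over F_q has at most k such steps
(`card_nondegenerate_back_le`). Neither LP moves if w_q is constant on F_q. Otherwise dim F_{q+1} <
dim F_q, which happens at most d times (`card_nonconstant_add_finrank_le`). Summing gives d(k +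
⌊k/2⌋).

The shadow rule must never get stuck before c is optimal. The LP over F_q in the second half starts
at a basis optimal for c on F_{q+1}. Since F_{q+1} maximizes w_q over F_q, this basis is optimal on
F_q for c + μ w_q with μ large (`parametric_start`). The rule is the parametric Simplex method
lowering μ to 0: a c-improving direction at a basis optimal for c - μa has positive a-value, and a
pivot along the steepest slope keeps optimality at the smaller parameter (`exists_shadow_direction`,
`parametric_update`). The chain starts at F_n, where every basis inequality is an equation.

Cycling is excluded by Bland's argument in the first half (`bland_acyclic`) and by strict increase
of a symbolically perturbed objective in the second (`exists_shadow_run`).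

A pivot stays in place or crosses an edge, so a run is a walk. For the diameter, P is written as a
polyhedron by Fourier–Motzkin elimination, the start u is the basic solution of some feasible basis,
and c is an objective maximized only at v. -/

theorem row_dotProduct_basicSol (hB : IsUnit (A.submatrix B id).det) (b : Fin m → ℝ) (l : Fin n) :
    A (B l) ⬝ᵥ basicSol A b B = b (B l) := by
  have h : A.submatrix B id *ᵥ basicSol A b B = fun i => b (B i) := by
    rw [basicSol, Matrix.mulVec_mulVec, Matrix.mul_nonsing_inv _ hB, Matrix.one_mulVec]
  exact congrFun h l

theorem row_dotProduct_edgeDir (hB : IsUnit (A.submatrix B id).det) (l i : Fin n) :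
    A (B l) ⬝ᵥ edgeDir A B i = if l = i then -1 else 0 := by
  have h := congrFun (congrFun (Matrix.mul_nonsing_inv (A.submatrix B id) hB) l) i
  rw [Matrix.mul_apply, Matrix.one_apply] at h
  have h2 : A (B l) ⬝ᵥ edgeDir A B i = -∑ j, A.submatrix B id l j * (A.submatrix B id)⁻¹ j i := by
    simp [dotProduct, edgeDir]
  rw [h2, h]
  split_ifs <;> simp

theorem eq_of_basis_rows_eq (hB : IsUnit (A.submatrix B id).det) {x y : Fin n → ℝ}
    (h : ∀ l, A (B l) ⬝ᵥ x = A (B l) ⬝ᵥ y) : x = y := by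
  have h' : A.submatrix B id *ᵥ x = A.submatrix B id *ᵥ y := funext h
  have := congrArg (fun z => (A.submatrix B id)⁻¹ *ᵥ z) h'
  simpa [Matrix.mulVec_mulVec, Matrix.nonsing_inv_mul _ hB] using this

theorem eq_basicSol (hB : IsUnit (A.submatrix B id).det) {b : Fin m → ℝ} {x : Fin n → ℝ}
    (h : ∀ l, A (B l) ⬝ᵥ x = b (B l)) : x = basicSol A b B :=
  eq_of_basis_rows_eq hB fun l => by rw [h, row_dotProduct_basicSol hB]

theorem eq_edgeDir (hB : IsUnit (A.submatrix B id).det) {i : Fin n} {x : Fin n → ℝ}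
    (h : ∀ l, A (B l) ⬝ᵥ x = if l = i then -1 else 0) : x = edgeDir A B i :=
  eq_of_basis_rows_eq hB fun l => by rw [h, row_dotProduct_edgeDir hB]

theorem edgeDir_ne_zero (hB : IsUnit (A.submatrix B id).det) (i : Fin n) : edgeDir A B i ≠ 0 := by
  intro h
  have := row_dotProduct_edgeDir hB i i
  simp [h] at this

/-- The edge directions are minus the dual basis of the basis rows. This expansion drives all later
computations with reduced costs. -/
theorem eq_sum_edgeDir (hB : IsUnit (A.submatrix B id).det) (y : Fin n → ℝ) :
    y = ∑ l, (-(A (B l) ⬝ᵥ y)) • edgeDir A B l := by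
  refine eq_of_basis_rows_eq hB fun l => ?_
  rw [dotProduct_sum]
  simp [dotProduct_smul, row_dotProduct_edgeDir hB]

theorem dotProduct_eq_sum_edgeDir (hB : IsUnit (A.submatrix B id).det) (w y : Fin n → ℝ) :
    w ⬝ᵥ y = -∑ l, (w ⬝ᵥ edgeDir A B l) * (A (B l) ⬝ᵥ y) := by
  conv_lhs => rw [eq_sum_edgeDir hB y]
  rw [dotProduct_sum, ← Finset.sum_neg_distrib]
  refine Finset.sum_congr rfl fun l _ => ?_
  rw [dotProduct_smul, smul_eq_mul]; ring

/-- The objective value of a point in terms of its slacks. -/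
theorem dotProduct_eq_basicSol_add (hB : IsUnit (A.submatrix B id).det) (b : Fin m → ℝ)
    (w x : Fin n → ℝ) :
    w ⬝ᵥ x = w ⬝ᵥ basicSol A b B +
      ∑ l, (w ⬝ᵥ edgeDir A B l) * (b (B l) - A (B l) ⬝ᵥ x) := by
  have h := dotProduct_eq_sum_edgeDir hB w (x - basicSol A b B)
  rw [dotProduct_sub, ← Finset.sum_neg_distrib] at h
  rw [← sub_eq_iff_eq_add', h]
  refine Finset.sum_congr rfl fun l _ => ?_
  rw [dotProduct_sub, row_dotProduct_basicSol hB]; ring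

theorem injective_of_isUnit_det (hB : IsUnit (A.submatrix B id).det) : Function.Injective B := by
  intro l i h
  by_contra hne
  have h1 := row_dotProduct_edgeDir hB l i
  have h2 := row_dotProduct_edgeDir hB i i
  rw [h, h2] at h1
  simp [hne] at h1

theorem isUnit_det_of_forall_eq_zero
    (h : ∀ y : Fin n → ℝ, (∀ l, A (B l) ⬝ᵥ y = 0) → y = 0) : IsUnit (A.submatrix B id).det := by
  rw [isUnit_iff_ne_zero]
  intro h0
  obtain ⟨v, hv, hv0⟩ := Matrix.exists_mulVec_eq_zero_iff.mpr h0
  exact hv (h v fun l => congrFun hv0 l)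

theorem isUnit_det_update (hB : IsUnit (A.submatrix B id).det) {i : Fin n} {s : Fin m}
    (hs : A s ⬝ᵥ edgeDir A B i ≠ 0) :
    IsUnit (A.submatrix (Function.update B i s) id).det := by
  refine isUnit_det_of_forall_eq_zero fun y hy => ?_
  -- A vector killed by the new rows can differ from 0 only in its product with row `B i`; expanding
  -- the product with row `s` removes that too, as the pivot element is nonzero.
  have hl : ∀ l, l ≠ i → A (B l) ⬝ᵥ y = 0 := fun l hl => by
    simpa [Function.update_of_ne hl] using hy l
  have hsy : A s ⬝ᵥ y = 0 := by simpa using hy i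
  have key := dotProduct_eq_sum_edgeDir hB (A s) y
  rw [Finset.sum_eq_single i (fun l _ h => by simp [hl l h]) (by simp), hsy] at key
  have hi : A (B i) ⬝ᵥ y = 0 := by
    rcases mul_eq_zero.mp (neg_eq_zero.mp key.symm) with h | h
    · exact absurd h hs
    · exact h
  refine eq_of_basis_rows_eq hB fun l => ?_
  by_cases h : l = i
  · simp [h, hi]
  · simp [hl l h]

theorem basicSol_update (hB : IsUnit (A.submatrix B id).det) (b : Fin m → ℝ) {i : Fin n}
    {s : Fin m} (hs : A s ⬝ᵥ edgeDir A B i ≠ 0) :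
    basicSol A b (Function.update B i s) =
      basicSol A b B + stepRatio A b B i s • edgeDir A B i := by
  refine (eq_basicSol (isUnit_det_update hB hs) fun l => ?_).symm
  by_cases h : l = i
  · subst h
    simp only [Function.update_self, dotProduct_add, dotProduct_smul, smul_eq_mul, stepRatio]
    rw [div_mul_cancel₀ _ hs]; ring
  · simp [dotProduct_add, dotProduct_smul, row_dotProduct_edgeDir hB, h,
      row_dotProduct_basicSol hB]

theorem edgeDir_update_self (hB : IsUnit (A.submatrix B id).det) {i : Fin n} {s : Fin m}
    (hs : A s ⬝ᵥ edgeDir A B i ≠ 0) :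
    edgeDir A (Function.update B i s) i = (-(A s ⬝ᵥ edgeDir A B i)⁻¹) • edgeDir A B i := by
  refine (eq_edgeDir (isUnit_det_update hB hs) fun l => ?_).symm
  by_cases h : l = i
  · subst h
    simp [hs]
  · simp [row_dotProduct_edgeDir hB, h]

theorem edgeDir_update_of_ne (hB : IsUnit (A.submatrix B id).det) {i l : Fin n} {s : Fin m}
    (hs : A s ⬝ᵥ edgeDir A B i ≠ 0) (hl : l ≠ i) :
    edgeDir A (Function.update B i s) l =
      edgeDir A B l - ((A s ⬝ᵥ edgeDir A B l) / (A s ⬝ᵥ edgeDir A B i)) • edgeDir A B i := by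
  refine (eq_edgeDir (isUnit_det_update hB hs) fun l' => ?_).symm
  by_cases h : l' = i
  · subst h
    simp [dotProduct_sub, hs, Ne.symm hl]
  · simp [row_dotProduct_edgeDir hB, h, dotProduct_sub]

theorem row_dotProduct_edgeDir_nonpos (hB : IsUnit (A.submatrix B id).det) (l i : Fin n) :
    A (B l) ⬝ᵥ edgeDir A B i ≤ 0 := by
  rw [row_dotProduct_edgeDir hB]; split_ifs <;> norm_num

theorem Blocks.notMem_range (hB : IsUnit (A.submatrix B id).det) {i : Fin n} {s : Fin m}
    (hs : Blocks A B i s) : s ∉ Set.range B := by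
  rintro ⟨l, rfl⟩
  exact absurd (row_dotProduct_edgeDir_nonpos hB l i) (not_le.mpr hs)

theorem mem_range_update_of_mem {E : Finset (Fin m)} {i : Fin n} {s : Fin m} (hi : B i ∉ E)
    (hE : ∀ r ∈ E, r ∈ Set.range B) : ∀ r ∈ E, r ∈ Set.range (Function.update B i s) := by
  intro r hr
  obtain ⟨l, rfl⟩ := hE r hr
  refine ⟨l, Function.update_of_ne ?_ _ _⟩
  rintro rfl
  exact hi hr

/-- Reduced costs read off a representation of the objective by rows of the basis. -/
theorem dotProduct_edgeDir_of_multipliers (hB : IsUnit (A.submatrix B id).det)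
    {w : Fin n → ℝ} {y : Fin m → ℝ} (hw : w = ∑ r, y r • A r)
    (hy : ∀ r, y r ≠ 0 → r ∈ Set.range B) (l : Fin n) : w ⬝ᵥ edgeDir A B l = -y (B l) := by
  rw [hw, sum_dotProduct, Finset.sum_eq_single (B l)]
  · simp [smul_dotProduct, row_dotProduct_edgeDir hB]
  · intro r _ hr
    rw [smul_dotProduct, smul_eq_mul]
    by_cases h : y r = 0
    · simp [h]
    · obtain ⟨l', rfl⟩ := hy r h
      rw [row_dotProduct_edgeDir hB, if_neg (fun h => hr (by rw [h])), mul_zero]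
  · simp

/-- The multipliers are indexed by all inequalities and not by basis positions, so they keep their
meaning at any later basis that contains their support. -/
theorem exists_multipliers (hB : IsUnit (A.submatrix B id).det) (w : Fin n → ℝ) :
    ∃ y : Fin m → ℝ, w = ∑ r, y r • A r ∧ (∀ r, y r ≠ 0 → r ∈ Set.range B) ∧
      ∀ l, y (B l) = -(w ⬝ᵥ edgeDir A B l) := by
  classical
  have hinj := injective_of_isUnit_det hB
  let y : Fin m → ℝ := fun r => ∑ l, if B l = r then -(w ⬝ᵥ edgeDir A B l) else 0
  have hyB : ∀ l, y (B l) = -(w ⬝ᵥ edgeDir A B l) := fun l => by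
    simp [y, hinj.eq_iff]
  refine ⟨y, ?_, ?_, hyB⟩
  · refine dotProduct_eq _ _ fun v => ?_
    rw [dotProduct_eq_sum_edgeDir hB w v, sum_dotProduct, ← Finset.sum_neg_distrib]
    simp only [y, smul_dotProduct, smul_eq_mul, Finset.sum_mul]
    rw [Finset.sum_comm]
    refine Finset.sum_congr rfl fun l _ => ?_
    simp [ite_mul]
  · intro r hr
    by_contra h
    exact hr (Finset.sum_eq_zero fun l _ => if_neg fun hl => h ⟨l, hl⟩)

end BasisAlgebra

/-! ### Geometry of faces and pivots -/

section Geometry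

variable {m n : ℕ} {A : Matrix (Fin m) (Fin n) ℝ} {b : Fin m → ℝ} {B : Fin n → Fin m}
  {E : Finset (Fin m)}

theorem dotProduct_continuousLinearMap (w : Fin n → ℝ) :
    ∃ l : StrongDual ℝ (Fin n → ℝ), ∀ x, l x = w ⬝ᵥ x := by
  refine ⟨LinearMap.toContinuousLinearMap
    { toFun := fun x => w ⬝ᵥ x
      map_add' := fun x y => dotProduct_add w x y
      map_smul' := fun t x => by simp [dotProduct_smul] }, fun x => rfl⟩

theorem isExposed_maximizers (P : Set (Fin n → ℝ)) (w : Fin n → ℝ) :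
    IsExposed ℝ P (maximizers P w) := by
  obtain ⟨l, hl⟩ := dotProduct_continuousLinearMap w
  intro _
  exact ⟨l, by simp [maximizers, hl]⟩

theorem faceOf_empty (A : Matrix (Fin m) (Fin n) ℝ) (b : Fin m → ℝ) :
    faceOf A b ∅ = polyhedron A b := by
  simp [faceOf]

/-- The sum of the rows in `E` is bounded by the sum of their right-hand sides, with equality only
if each row is tight. Nonemptiness guarantees that this bound is attained. -/
theorem faceOf_eq_maximizers (hne : (faceOf A b E).Nonempty) :
    faceOf A b E = maximizers (polyhedron A b) (∑ r ∈ E, A r) := by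
  have hsum : ∀ x, (∑ r ∈ E, A r) ⬝ᵥ x = ∑ r ∈ E, A r ⬝ᵥ x := fun x => sum_dotProduct _ _ _
  obtain ⟨z, hz⟩ := hne
  ext x
  constructor
  · intro hx
    refine ⟨hx.1, fun y hy => ?_⟩
    rw [hsum, hsum]
    exact Finset.sum_le_sum fun r hr => by rw [hx.2 r hr]; exact hy r
  · intro hx
    refine ⟨hx.1, ?_⟩
    have h1 := hx.2 z hz.1
    rw [hsum, hsum, Finset.sum_congr rfl hz.2] at h1
    have h2 : ∑ r ∈ E, A r ⬝ᵥ x = ∑ r ∈ E, b r :=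
      le_antisymm (Finset.sum_le_sum fun r _ => hx.1 r) h1
    exact (Finset.sum_eq_sum_iff_of_le fun r _ => hx.1 r).mp h2

theorem isExposed_faceOf : IsExposed ℝ (polyhedron A b) (faceOf A b E) := fun hne => by
  have h := isExposed_maximizers (polyhedron A b) (∑ r ∈ E, A r)
  rw [← faceOf_eq_maximizers hne] at h
  exact h hne

theorem basicSol_mem_faceOf (hB : IsFeasibleBasis A b B) (hE : ∀ r ∈ E, r ∈ Set.range B) :
    basicSol A b B ∈ faceOf A b E := by
  refine ⟨hB.2, fun r hr => ?_⟩
  obtain ⟨l, rfl⟩ := hE r hr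
  exact row_dotProduct_basicSol hB.1 b l

theorem faceOf_image_univ (hB : IsFeasibleBasis A b B) :
    faceOf A b (Finset.univ.image B) = {basicSol A b B} := by
  ext x
  constructor
  · exact fun hx => eq_basicSol hB.1 fun l => hx.2 _ (by simp)
  · rintro rfl
    exact basicSol_mem_faceOf hB (by simp)

theorem basicSol_mem_extremePoints (hB : IsFeasibleBasis A b B) :
    basicSol A b B ∈ (polyhedron A b).extremePoints ℝ := by
  have h := (isExposed_faceOf (A := A) (b := b) (E := Finset.univ.image B)).isExtreme
  rw [faceOf_image_univ hB] at h
  exact isExtreme_singleton.mp h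

/-- A basis passing the optimality test is optimal. -/
theorem basicSol_mem_maximizers (hB : IsFeasibleBasis A b B) (hE : ∀ r ∈ E, r ∈ Set.range B)
    {w : Fin n → ℝ} (hopt : IsOptimalBasis A E w B) :
    basicSol A b B ∈ maximizers (faceOf A b E) w := by
  refine ⟨basicSol_mem_faceOf hB hE, fun x hx => ?_⟩
  rw [dotProduct_eq_basicSol_add hB.1 b w x]
  refine add_le_of_nonpos_right (Finset.sum_nonpos fun l _ => ?_)
  by_cases hl : B l ∈ E
  · rw [hx.2 _ hl]; simp
  · exact mul_nonpos_of_nonpos_of_nonneg (hopt l hl) (sub_nonneg.mpr (hx.1 _))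

theorem mem_nextFace {w : Fin n → ℝ} {r : Fin m} :
    r ∈ nextFace A E w B ↔ r ∈ E ∨ ∃ l, w ⬝ᵥ edgeDir A B l < 0 ∧ B l = r := by
  simp [nextFace]

theorem nextFace_subset_range (hE : ∀ r ∈ E, r ∈ Set.range B) {w : Fin n → ℝ} :
    ∀ r ∈ nextFace A E w B, r ∈ Set.range B := by
  intro r hr
  rcases mem_nextFace.mp hr with h | ⟨l, -, rfl⟩
  · exact hE r h
  · exact ⟨l, rfl⟩

/-- Complementary slackness: on the face, the objective is its optimal value plus terms (reduced
cost) · (slack), all nonpositive. A point is optimal exactly when every term vanishes, i.e. when the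
slacks of negative reduced cost are zero. -/
theorem faceOf_nextFace (hB : IsFeasibleBasis A b B) (hE : ∀ r ∈ E, r ∈ Set.range B)
    {w : Fin n → ℝ} (hopt : IsOptimalBasis A E w B) :
    faceOf A b (nextFace A E w B) = maximizers (faceOf A b E) w := by
  have hmax := basicSol_mem_maximizers hB hE hopt
  have hterm : ∀ x ∈ faceOf A b E, ∀ l,
      (w ⬝ᵥ edgeDir A B l) * (b (B l) - A (B l) ⬝ᵥ x) ≤ 0 := by
    intro x hx l
    by_cases hl : B l ∈ E
    · rw [hx.2 _ hl]; simp
    · exact mul_nonpos_of_nonpos_of_nonneg (hopt l hl) (sub_nonneg.mpr (hx.1 _))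
  ext x
  constructor
  · intro hx
    have hxE : x ∈ faceOf A b E := ⟨hx.1, fun r hr => hx.2 r (mem_nextFace.mpr (Or.inl hr))⟩
    refine ⟨hxE, fun y hy => (hmax.2 y hy).trans ?_⟩
    rw [dotProduct_eq_basicSol_add hB.1 b w x]
    refine le_add_of_nonneg_right (Finset.sum_nonneg fun l _ => ?_)
    by_cases hl : B l ∈ nextFace A E w B
    · rw [hx.2 _ hl]; simp
    · refine mul_nonneg (not_lt.mp fun h => hl (mem_nextFace.mpr (Or.inr ⟨l, h, rfl⟩)))
        (sub_nonneg.mpr (hx.1 _))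
  · intro hx
    refine ⟨hx.1.1, fun r hr => ?_⟩
    rcases mem_nextFace.mp hr with h | ⟨l, hl, rfl⟩
    · exact hx.1.2 r h
    · have h1 := hx.2 _ hmax.1
      rw [dotProduct_eq_basicSol_add hB.1 b w x] at h1
      have h2 := Finset.sum_nonpos fun l (_ : l ∈ Finset.univ) => hterm x hx.1 l
      have h3 := (Finset.sum_eq_zero_iff_of_nonpos fun l (_ : l ∈ Finset.univ) =>
        hterm x hx.1 l).mp (by linarith) l (Finset.mem_univ l)
      rcases mul_eq_zero.mp h3 with h | h
      · exact absurd h hl.ne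
      · linarith

/-- The multipliers of an optimal basis certify the face they define. -/
theorem exists_multipliers_nextFace (hB : IsUnit (A.submatrix B id).det)
    {w : Fin n → ℝ} (hopt : IsOptimalBasis A E w B) :
    ∃ y : Fin m → ℝ, w = ∑ r, y r • A r ∧ (∀ r, y r ≠ 0 → r ∈ nextFace A E w B) ∧
      ∀ r ∈ nextFace A E w B, r ∉ E → 0 < y r := by
  obtain ⟨y, hw, hsupp, hy⟩ := exists_multipliers hB w
  refine ⟨y, hw, fun r hr => ?_, fun r hr hrE => ?_⟩
  · obtain ⟨l, rfl⟩ := hsupp r hr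
    by_cases hl : B l ∈ E
    · exact mem_nextFace.mpr (Or.inl hl)
    · refine mem_nextFace.mpr (Or.inr ⟨l, lt_of_le_of_ne (hopt l hl) fun h => hr ?_, rfl⟩)
      rw [hy, h, neg_zero]
  · rcases mem_nextFace.mp hr with h | ⟨l, hl, rfl⟩
    · exact absurd h hrE
    · rw [hy]; linarith

/-! #### Pivots -/

theorem Blocks.ne_zero {i : Fin n} {s : Fin m} (hs : Blocks A B i s) :
    A s ⬝ᵥ edgeDir A B i ≠ 0 :=
  ne_of_gt hs

theorem exists_blocks (hB : IsFeasibleBasis A b B)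
    (hbdd : Bornology.IsBounded (polyhedron A b)) (i : Fin n) : ∃ s, Blocks A B i s := by
  by_contra! hno
  set u := edgeDir A B i with hu
  obtain ⟨R, hR⟩ := hbdd.subset_closedBall (basicSol A b B)
  have hupos : 0 < ‖u‖ := norm_pos_iff.mpr (edgeDir_ne_zero hB.1 i)
  have hmem : ∀ t : ℝ, 0 ≤ t → basicSol A b B + t • u ∈ polyhedron A b := by
    intro t ht r
    have h1 : A r ⬝ᵥ u ≤ 0 := not_lt.mp (hno r)
    have h2 := hB.2 r
    rw [dotProduct_add, dotProduct_smul, smul_eq_mul]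
    nlinarith
  -- An unblocked direction is a ray in the polyhedron; this step length gives displacement of norm
  -- `|R| + 1`, which leaves the ball of radius `R`.
  have h := hR (hmem ((|R| + 1) / ‖u‖) (by positivity))
  rw [Metric.mem_closedBall, dist_eq_norm, add_sub_cancel_left, norm_smul, Real.norm_eq_abs,
    abs_of_nonneg (by positivity), div_mul_cancel₀ _ hupos.ne'] at h
  linarith [le_abs_self R]

theorem stepRatio_nonneg (hB : IsFeasibleBasis A b B) {i : Fin n} {s : Fin m}
    (hs : Blocks A B i s) : 0 ≤ stepRatio A b B i s :=
  div_nonneg (sub_nonneg.mpr (hB.2 s)) hs.le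

theorem IsPivot.isFeasibleBasis (hB : IsFeasibleBasis A b B) {w : Fin n → ℝ} {i : Fin n}
    {s : Fin m} (h : IsPivot A b E w B i s) : IsFeasibleBasis A b (Function.update B i s) := by
  have hs : A s ⬝ᵥ edgeDir A B i ≠ 0 := h.2.2.1.ne_zero
  refine ⟨isUnit_det_update hB.1 hs, fun r => ?_⟩
  rw [basicSol_update hB.1 b hs, dotProduct_add, dotProduct_smul, smul_eq_mul]
  have h0 := stepRatio_nonneg hB h.2.2.1
  by_cases hr : Blocks A B i r
  · have h1 := h.2.2.2 r hr
    rw [stepRatio, stepRatio, le_div_iff₀ hr] at h1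
    rw [stepRatio]; linarith
  · have h1 : A r ⬝ᵥ edgeDir A B i ≤ 0 := not_lt.mp hr
    have h2 := hB.2 r
    nlinarith

theorem stepRatio_pos_of_ne (hB : IsFeasibleBasis A b B) {i : Fin n} {s : Fin m}
    (hs : Blocks A B i s) (hne : basicSol A b B ≠ basicSol A b (Function.update B i s)) :
    0 < stepRatio A b B i s := by
  refine lt_of_le_of_ne (stepRatio_nonneg hB hs) fun h => hne ?_
  rw [basicSol_update hB.1 b hs.ne_zero, ← h]; simp

theorem dotProduct_lt_of_pivot (hB : IsFeasibleBasis A b B) {i : Fin n} {s : Fin m}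
    (hs : Blocks A B i s) (hne : basicSol A b B ≠ basicSol A b (Function.update B i s))
    {w : Fin n → ℝ} (hw : 0 < w ⬝ᵥ edgeDir A B i) :
    w ⬝ᵥ basicSol A b B < w ⬝ᵥ basicSol A b (Function.update B i s) := by
  rw [basicSol_update hB.1 b hs.ne_zero, dotProduct_add, dotProduct_smul, smul_eq_mul]
  have := mul_pos (stepRatio_pos_of_ne hB hs hne) hw
  linarith

/-- A pivot moves along an edge of the polyhedron, or stays in place. -/
theorem IsPivot.isExposed_segment (hB : IsFeasibleBasis A b B) {w : Fin n → ℝ} {i : Fin n}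
    {s : Fin m} (h : IsPivot A b E w B i s) :
    IsExposed ℝ (polyhedron A b)
      (segment ℝ (basicSol A b B) (basicSol A b (Function.update B i s))) := by
  by_cases hne : basicSol A b B = basicSol A b (Function.update B i s)
  · rw [← hne, segment_same, ← faceOf_image_univ hB]
    exact isExposed_faceOf
  have hs : A s ⬝ᵥ edgeDir A B i ≠ 0 := h.2.2.1.ne_zero
  have hB' := h.isFeasibleBasis hB
  have hθ := stepRatio_pos_of_ne hB h.2.2.1 hne
  -- The edge is the face on which all basis rows but the relaxed one are tight.
  suffices hseg : segment ℝ (basicSol A b B) (basicSol A b (Function.update B i s)) =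
      faceOf A b ((Finset.univ.erase i).image B) by
    rw [hseg]; exact isExposed_faceOf
  have hupd := basicSol_update hB.1 b hs
  set θ := stepRatio A b B i s with hθd
  set x := basicSol A b B with hx
  set u := edgeDir A B i with hu
  rw [hupd, segment_eq_image']
  have hrow : ∀ l, l ≠ i → ∀ t : ℝ, A (B l) ⬝ᵥ (x + t • u) = b (B l) := by
    intro l hl t
    rw [dotProduct_add, dotProduct_smul, row_dotProduct_basicSol hB.1, row_dotProduct_edgeDir hB.1,
      if_neg hl]; simp
  ext z
  constructor
  · rintro ⟨t, ⟨ht0, ht1⟩, rfl⟩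
    have hz : x + t • (x + θ • u - x) = x + (t * θ) • u := by
      rw [add_sub_cancel_left, smul_smul]
    refine ⟨fun r => ?_, fun r hr => ?_⟩
    · have h1 := hB.2 r
      have h2 := hB'.2 r
      rw [hupd] at h2
      have : x + t • (x + θ • u - x) = (1 - t) • x + t • (x + θ • u) := by module
      change A r ⬝ᵥ (x + t • (x + θ • u - x)) ≤ b r
      rw [this, dotProduct_add, dotProduct_smul, dotProduct_smul, smul_eq_mul, smul_eq_mul]
      nlinarith
    · obtain ⟨l, hl, rfl⟩ := Finset.mem_image.mp hr
      change A (B l) ⬝ᵥ (x + t • (x + θ • u - x)) = _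
      rw [hz]
      exact hrow l (Finset.ne_of_mem_erase hl) _
  · intro hz
    -- As row `B i` has product -1 with `u`, its slack is the parameter along `u`; row `s` caps it
    -- at `θ`.
    set τ := b (B i) - A (B i) ⬝ᵥ z with hτ
    have hzx : z = x + τ • u := by
      refine eq_of_basis_rows_eq hB.1 fun l => ?_
      by_cases hl : l = i
      · subst hl
        rw [dotProduct_add, dotProduct_smul, row_dotProduct_basicSol hB.1,
          row_dotProduct_edgeDir hB.1, if_pos rfl, smul_eq_mul, hτ]
        ring
      · rw [hrow l hl]
        exact hz.2 _ (Finset.mem_image.mpr ⟨l, by simp [hl], rfl⟩)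
    have hτ0 : 0 ≤ τ := sub_nonneg.mpr (hz.1 _)
    have hτθ : τ ≤ θ := by
      have h1 := hz.1 s
      rw [hzx, dotProduct_add, dotProduct_smul, smul_eq_mul] at h1
      rw [hθd, stepRatio, le_div_iff₀ h.2.2.1]
      linarith
    refine ⟨τ / θ, ⟨by positivity, (div_le_one hθ).mpr hτθ⟩, ?_⟩
    change x + (τ / θ) • (x + θ • u - x) = z
    rw [add_sub_cancel_left, smul_smul, div_mul_cancel₀ _ hθ.ne', hzx]

end Geometry

/-! ### Finite termination of step relations -/

/-- Iterating a choice of steps without ever reaching `Opt` would give an infinite run in a finite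
set, hence a repetition. The invariant is carried along because steps are only supplied where it
holds. -/
theorem exists_run_of_acyclic {α : Type*} [Finite α] {R : α → α → Prop} {Opt Inv : α → Prop}
    (hstep : ∀ x, Inv x → ¬ Opt x → ∃ y, R x y ∧ Inv y)
    (hacyclic : ∀ f : ℕ → α, (∀ r, Inv (f r) ∧ R (f r) (f (r + 1))) → ∀ p q, p < q → f p ≠ f q)
    (x : α) (hx : Inv x) :
    ∃ (L : ℕ) (f : ℕ → α), f 0 = x ∧ Opt (f L) ∧ ∀ p < L, R (f p) (f (p + 1)) := by
  classical
  choose! g hgR hgI using hstep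
  let f : ℕ → α := fun p => g^[p] x
  have hf : ∀ p, f (p + 1) = g (f p) := fun p => Function.iterate_succ_apply' g p x
  by_cases hL : ∃ L, Opt (f L)
  · have hmin : ∀ p < Nat.find hL, ¬ Opt (f p) := fun p hp => Nat.find_min hL hp
    have hinv : ∀ p ≤ Nat.find hL, Inv (f p) := by
      intro p
      induction p with
      | zero => exact fun _ => hx
      | succ p ih =>
        intro hp
        rw [hf]
        exact hgI _ (ih (by omega)) (hmin p (by omega))
    refine ⟨Nat.find hL, f, rfl, Nat.find_spec hL, fun p hp => ?_⟩
    rw [hf]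
    exact hgR _ (hinv p hp.le) (hmin p hp)
  · push Not at hL
    have hinv : ∀ p, Inv (f p) := by
      intro p
      induction p with
      | zero => exact hx
      | succ p ih => rw [hf]; exact hgI _ ih (hL p)
    obtain ⟨p, q, hpq, heq⟩ := Finite.exists_ne_map_eq_of_infinite f
    have hac := hacyclic f fun r => ⟨hinv r, by rw [hf]; exact hgR _ (hinv r) (hL r)⟩
    rcases lt_or_gt_of_ne hpq with h | h
    · exact absurd heq (hac p q h)
    · exact absurd heq.symm (hac q p h)

theorem exists_last_of_not {P : ℕ → Prop} {a b : ℕ} (hab : a ≤ b) (ha : P a) (hb : ¬ P b) :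
    ∃ r, a ≤ r ∧ r < b ∧ P r ∧ ¬ P (r + 1) := by
  by_contra! h
  refine hb (Nat.le_induction (P := fun r _ => r ≤ b → P r) (fun _ => ha) ?_ b hab le_rfl)
  intro r har ih hrb
  exact h r har (by omega) (ih (by omega))

/-! ### Termination of Bland's rule -/

section Bland

variable {m n : ℕ} {A : Matrix (Fin m) (Fin n) ℝ} {b : Fin m → ℝ} {E : Finset (Fin m)}
  {w : Fin n → ℝ}

theorem dotProduct_basicSol_le_of_pivot {B : Fin n → Fin m} (hB : IsFeasibleBasis A b B)
    {i : Fin n} {s : Fin m} (h : IsPivot A b E w B i s) :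
    w ⬝ᵥ basicSol A b B ≤ w ⬝ᵥ basicSol A b (Function.update B i s) := by
  by_cases hne : basicSol A b B = basicSol A b (Function.update B i s)
  · rw [← hne]
  · exact (dotProduct_lt_of_pivot hB h.2.2.1 hne h.2.1).le

theorem notMem_range_update {B : Fin n → Fin m} (hB : Function.Injective B) {i : Fin n}
    {s : Fin m} (hs : s ∉ Set.range B) : B i ∉ Set.range (Function.update B i s) := by
  rintro ⟨l, hl⟩
  by_cases h : l = i
  · subst h
    rw [Function.update_self] at hl
    exact hs ⟨l, hl.symm⟩
  · rw [Function.update_of_ne h] at hl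
    exact h (hB hl)

theorem eq_of_notMem_range_update {B : Fin n → Fin m} {i : Fin n} {s t : Fin m}
    (ht : t ∈ Set.range B) (ht' : t ∉ Set.range (Function.update B i s)) : B i = t := by
  obtain ⟨l, rfl⟩ := ht
  by_contra h
  exact ht' ⟨l, Function.update_of_ne (fun hl => h (by rw [hl])) _ _⟩

theorem eq_of_mem_range_update {B : Fin n → Fin m} {i : Fin n} {s t : Fin m}
    (ht : t ∉ Set.range B) (ht' : t ∈ Set.range (Function.update B i s)) : s = t := by
  obtain ⟨l, hl⟩ := ht'
  by_cases h : l = i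
  · subst h; simpa using hl
  · rw [Function.update_of_ne h] at hl
    exact absurd ⟨l, hl⟩ ht

/-- The heart of Bland's theorem: among the indices that change their status along a sequence of
bases with a common basic solution, the largest one cannot both leave and enter. -/
theorem bland_leave_enter_false {B B' : Fin n → Fin m} (hB : IsFeasibleBasis A b B)
    (hB' : IsFeasibleBasis A b B') (hsol : basicSol A b B = basicSol A b B') {i i' : Fin n}
    {s t : Fin m} (h : IsBlandPivot A b E w B i t) (h' : IsBlandPivot A b E w B' i' s)
    (ht : B' i' = t)
    (hfick : ∀ l, B' l ≠ t → (B' l ∈ Set.range B ∧ B' l ≠ B i) ∨ (B' l ∉ E ∧ B' l < t)) :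
    False := by
  have hpos := h.1.2.1
  rw [dotProduct_eq_sum_edgeDir hB'.1] at hpos
  -- The direction that brings `t` into `B` is expanded in the basis `B'` that `t` leaves. At `t`
  -- both factors are positive. A row shared with `B` and not leaving it has product 0. For a
  -- smaller row outside `E`, the leaving choice at `B'` makes the reduced cost nonpositive, and the
  -- entering choice at `B` makes the product nonpositive, since such a row would tie at ratio 0. So
  -- the sum is nonnegative, against the improvement at `B`.
  have : 0 ≤ ∑ l, (w ⬝ᵥ edgeDir A B' l) * (A (B' l) ⬝ᵥ edgeDir A B i) := by
    refine Finset.sum_nonneg fun l _ => ?_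
    by_cases hl : B' l = t
    · have hli : l = i' := injective_of_isUnit_det hB'.1 (hl.trans ht.symm)
      subst hli
      rw [hl]
      exact (mul_pos h'.1.2.1 h.1.2.2.1).le
    rcases hfick l hl with ⟨⟨l', hl'⟩, hne⟩ | ⟨hE, hlt⟩
    · rw [← hl', row_dotProduct_edgeDir hB.1, if_neg (fun h => hne (by rw [← hl', h])), mul_zero]
    · refine mul_nonneg_of_nonpos_of_nonpos (not_lt.mp fun hc => ?_) (not_lt.mp fun hc => ?_)
      · have := h'.2.1 l hE hc
        rw [ht] at this
        exact absurd hlt (not_lt.mpr this)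
      · have hratio : stepRatio A b B i (B' l) = 0 := by
          rw [stepRatio, hsol, row_dotProduct_basicSol hB'.1, sub_self, zero_div]
        have hpiv : IsPivot A b E w B i (B' l) :=
          ⟨h.1.1, h.1.2.1, hc, fun s' hs' => by rw [hratio]; exact stepRatio_nonneg hB hs'⟩
        exact absurd hlt (not_lt.mpr (h.2.2 _ hpiv))
  linarith

/-- On a cycle the objective returns to its value, so all pivots are degenerate and share one basic
solution. The largest index that changes status on the cycle both leaves and enters, which
`bland_leave_enter_false` forbids. -/
theorem bland_acyclic (f : ℕ → Fin n → Fin m)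
    (hf : ∀ r, (IsFeasibleBasis A b (f r) ∧ ∀ e ∈ E, e ∈ Set.range (f r)) ∧
      ∃ i s, IsBlandPivot A b E w (f r) i s ∧ f (r + 1) = Function.update (f r) i s)
    (p q : ℕ) (hpq : p < q) : f p ≠ f q := by
  classical
  intro heq
  choose hfe i s hbl hupd using hf
  have hfeas := fun r => (hfe r).1
  have hE := fun r => (hfe r).2
  have hmono : Monotone fun r => w ⬝ᵥ basicSol A b (f r) := monotone_nat_of_le_succ fun r => by
    rw [hupd r]
    exact dotProduct_basicSol_le_of_pivot (hfeas r) (hbl r).1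
  have hsol : ∀ r, p ≤ r → r ≤ q → basicSol A b (f r) = basicSol A b (f p) := by
    intro r hpr
    refine Nat.le_induction (P := fun r _ => r ≤ q → basicSol A b (f r) = basicSol A b (f p))
      (fun _ => rfl) ?_ r hpr
    intro r hpr ih hrq
    rw [← ih (by omega)]
    by_contra hne
    have hlt := dotProduct_lt_of_pivot (hfeas r) (hbl r).1.2.2.1
      (by rw [← hupd r]; exact Ne.symm hne) (hbl r).1.2.1
    rw [← hupd r] at hlt
    have h1 := hmono hpr
    have h2 := hmono hrq
    simp only [heq] at h1
    simp only at h2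
    linarith
  -- The fickle indices: in some basis of the cycle and outside another.
  let F : Finset (Fin m) := Finset.univ.filter fun t =>
    (∃ r, p ≤ r ∧ r ≤ q ∧ t ∈ Set.range (f r)) ∧ ∃ r, p ≤ r ∧ r ≤ q ∧ t ∉ Set.range (f r)
  have hF : F.Nonempty := by
    refine ⟨s p, Finset.mem_filter.mpr ⟨Finset.mem_univ _, ⟨p + 1, by omega, by omega, ?_⟩,
      p, le_rfl, hpq.le, (hbl p).1.2.2.1.notMem_range (hfeas p).1⟩⟩
    rw [hupd p]
    exact ⟨i p, Function.update_self _ _ _⟩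
  obtain ⟨t, htF, htmax⟩ := F.exists_max_image id hF
  obtain ⟨-, ⟨c, hpc, hcq, htc⟩, d, hpd, hdq, htd⟩ := Finset.mem_filter.mp htF
  have hexists : (∃ r, p ≤ r ∧ r < q ∧ t ∈ Set.range (f r) ∧ t ∉ Set.range (f (r + 1))) ∧
      ∃ r, p ≤ r ∧ r < q ∧ t ∉ Set.range (f r) ∧ t ∈ Set.range (f (r + 1)) := by
    -- The status of `t` is the same at `p` and at `q`, so a change in one direction is undone
    -- within the window; only the order of the two changes depends on the case.
    by_cases htp : t ∈ Set.range (f p)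
    · obtain ⟨r₁, h1, h2, h3, h4⟩ := exists_last_of_not (P := fun r => t ∈ Set.range (f r))
        hpd htp htd
      obtain ⟨r₂, h5, h6, h7, h8⟩ := exists_last_of_not (P := fun r => t ∉ Set.range (f r))
        hdq htd (by rw [← heq]; exact not_not.mpr htp)
      exact ⟨⟨r₁, by omega, by omega, h3, h4⟩, r₂, by omega, by omega, h7, not_not.mp h8⟩
    · obtain ⟨r₁, h1, h2, h3, h4⟩ := exists_last_of_not (P := fun r => t ∈ Set.range (f r))
        hcq htc (by rw [← heq]; exact htp)
      obtain ⟨r₂, h5, h6, h7, h8⟩ := exists_last_of_not (P := fun r => t ∉ Set.range (f r))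
        hpc htp (not_not.mpr htc)
      exact ⟨⟨r₁, by omega, by omega, h3, h4⟩, r₂, by omega, by omega, h7, not_not.mp h8⟩
  obtain ⟨⟨r₁, hp1, hq1, hin1, hout1⟩, r₂, hp2, hq2, hout2, hin2⟩ := hexists
  rw [hupd r₁] at hout1
  rw [hupd r₂] at hin2
  have ht1 := eq_of_notMem_range_update hin1 hout1
  have ht2 := eq_of_mem_range_update hout2 hin2
  refine bland_leave_enter_false (hfeas r₂) (hfeas r₁)
    ((hsol r₂ hp2 hq2.le).trans (hsol r₁ hp1 hq1.le).symm) (ht2 ▸ hbl r₂) (hbl r₁) ht1 ?_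
  intro l hl
  by_cases hlF : f r₁ l ∈ F
  · refine Or.inr ⟨fun h => ?_, lt_of_le_of_ne (htmax _ hlF) hl⟩
    obtain ⟨-, -, r, -, -, hr⟩ := Finset.mem_filter.mp hlF
    exact hr (hE r _ h)
  · have hall : ∀ r, p ≤ r → r ≤ q → f r₁ l ∈ Set.range (f r) := by
      intro r hr1 hr2
      by_contra hr
      exact hlF (Finset.mem_filter.mpr ⟨Finset.mem_univ _,
        ⟨r₁, hp1, hq1.le, ⟨l, rfl⟩⟩, r, hr1, hr2, hr⟩)
    refine Or.inl ⟨hall r₂ hp2 hq2.le, fun h => ?_⟩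
    have h1 := hall (r₂ + 1) (by omega) (by omega)
    rw [h, hupd r₂] at h1
    exact notMem_range_update (injective_of_isUnit_det (hfeas r₂).1)
      ((hbl r₂).1.2.2.1.notMem_range (hfeas r₂).1) h1

theorem exists_blandPivot {B : Fin n → Fin m} (hB : IsFeasibleBasis A b B)
    (hbdd : Bornology.IsBounded (polyhedron A b)) (hopt : ¬ IsOptimalBasis A E w B) :
    ∃ i s, IsBlandPivot A b E w B i s := by
  classical
  unfold IsOptimalBasis at hopt
  push Not at hopt
  obtain ⟨i₀, hi₀⟩ := hopt
  obtain ⟨i, hi, himin⟩ := (Finset.univ.filter fun i =>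
    B i ∉ E ∧ 0 < w ⬝ᵥ edgeDir A B i).exists_min_image B ⟨i₀, by simpa using hi₀⟩
  simp only [Finset.mem_filter, Finset.mem_univ, true_and] at hi himin
  obtain ⟨s₀, hs₀⟩ := exists_blocks hB hbdd i
  obtain ⟨s₁, hs₁, hs₁min⟩ := (Finset.univ.filter fun s => Blocks A B i s).exists_min_image
    (stepRatio A b B i) ⟨s₀, by simpa using hs₀⟩
  simp only [Finset.mem_filter, Finset.mem_univ, true_and] at hs₁ hs₁min
  obtain ⟨s, hs, hsmin⟩ := (Finset.univ.filter fun s => IsPivot A b E w B i s).exists_min_image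
    id ⟨s₁, by simpa using ⟨hi.1, hi.2, hs₁, hs₁min⟩⟩
  simp only [Finset.mem_filter, Finset.mem_univ, true_and] at hs hsmin
  exact ⟨i, s, hs, fun i' h1 h2 => himin i' ⟨h1, h2⟩, hsmin⟩

/-- The Simplex method with Bland's rule terminates at an optimal basis. -/
theorem exists_bland_run {B : Fin n → Fin m} (hB : IsFeasibleBasis A b B)
    (hE : ∀ r ∈ E, r ∈ Set.range B) (hbdd : Bornology.IsBounded (polyhedron A b))
    (w : Fin n → ℝ) :
    ∃ (L : ℕ) (f : ℕ → Fin n → Fin m), f 0 = B ∧ IsOptimalBasis A E w (f L) ∧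
      ∀ p < L, ∃ i s, IsBlandPivot A b E w (f p) i s ∧
        f (p + 1) = Function.update (f p) i s := by
  refine exists_run_of_acyclic
    (R := fun B B' => ∃ i s, IsBlandPivot A b E w B i s ∧ B' = Function.update B i s)
    (Opt := IsOptimalBasis A E w)
    (Inv := fun B => IsFeasibleBasis A b B ∧ ∀ e ∈ E, e ∈ Set.range B) ?_ bland_acyclic B ⟨hB, hE⟩
  rintro B ⟨hB, hE⟩ hopt
  obtain ⟨i, s, h⟩ := exists_blandPivot hB hbdd hopt
  exact ⟨_, ⟨i, s, h, rfl⟩, h.1.isFeasibleBasis hB, mem_range_update_of_mem h.1.1 hE⟩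

end Bland

/-! ### Lexicographic positivity -/

section Lexicographic

variable {N : ℕ}

/-- The first nonzero entry is positive. -/
def LexPos (v : Fin N → ℝ) : Prop := ∃ i, (∀ j < i, v j = 0) ∧ 0 < v i

theorem toLex_lt_toLex_iff {x y : Fin N → ℝ} : toLex x < toLex y ↔ LexPos (y - x) := by
  constructor
  · rintro ⟨i, hi, hlt⟩
    exact ⟨i, fun j hj => sub_eq_zero.mpr (hi j hj).symm, sub_pos.mpr hlt⟩
  · rintro ⟨i, hi, hlt⟩
    exact ⟨i, fun j hj => (sub_eq_zero.mp (hi j hj)).symm, sub_pos.mp hlt⟩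

theorem LexPos.smul {v : Fin N → ℝ} (hv : LexPos v) {c : ℝ} (hc : 0 < c) : LexPos (c • v) := by
  obtain ⟨i, hi, hpos⟩ := hv
  exact ⟨i, fun j hj => by simp [hi j hj], mul_pos hc hpos⟩

theorem LexPos.add {u v : Fin N → ℝ} (hu : LexPos u) (hv : LexPos v) : LexPos (u + v) := by
  obtain ⟨i, hi, hipos⟩ := hu
  obtain ⟨j, hj, hjpos⟩ := hv
  rcases lt_trichotomy i j with h | h | h
  · exact ⟨i, fun l hl => by simp [hi l hl, hj l (hl.trans h)], by simpa [hj i h] using hipos⟩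
  · subst h
    exact ⟨i, fun l hl => by simp [hi l hl, hj l hl], add_pos hipos hjpos⟩
  · exact ⟨j, fun l hl => by simp [hj l hl, hi l (hl.trans h)], by simpa [hi j h] using hjpos⟩

theorem LexPos.add_smul {u v : Fin N → ℝ} (hu : LexPos u) (hv : LexPos v) {c : ℝ} (hc : 0 ≤ c) :
    LexPos (u + c • v) := by
  rcases hc.eq_or_lt with rfl | hc
  · simpa using hu
  · exact hu.add (hv.smul hc)

/-- Entry 0 of a lexicographic ratio is the ordinary ratio, so the lexicographic test selects among
the winners of the ordinary one. -/
theorem apply_zero_le_of_toLex_lt {x y : Fin (N + 1) → ℝ} (h : toLex x < toLex y) :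
    x 0 ≤ y 0 := by
  obtain ⟨i, hi, hlt⟩ := h
  rcases Fin.eq_zero_or_eq_succ i with rfl | ⟨j, rfl⟩
  · exact hlt.le
  · exact (hi 0 (Fin.succ_pos j)).le

end Lexicographic

/-! ### The lexicographic ratio test -/

section LexRatio

variable {m n : ℕ} {A : Matrix (Fin m) (Fin n) ℝ} {b : Fin m → ℝ} {B₀ B : Fin n → Fin m}

open Classical in
/-- The right-hand sides that make up the symbolic perturbation of `b` outside `B₀`. -/
noncomputable def lexRhs (b : Fin m → ℝ) (B₀ : Fin n → Fin m) : Fin (m + 1) → Fin m → ℝ :=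
  Fin.cons b fun t r => if t ∈ Set.range B₀ then 0 else if r = t then 1 else 0

/-- Slacks are linear in the right-hand side, so each entry is the slack for one right-hand side.
The pivot formulas, valid for every right-hand side, then apply entrywise. -/
theorem lexRow_eq (hB : IsUnit (A.submatrix B id).det) (b : Fin m → ℝ) (B₀ : Fin n → Fin m)
    (s : Fin m) (t : Fin (m + 1)) :
    lexRow A b B₀ B s t = lexRhs b B₀ t s - A s ⬝ᵥ basicSol A (lexRhs b B₀ t) B := by
  classical
  rcases Fin.eq_zero_or_eq_succ t with rfl | ⟨t, rfl⟩
  · rfl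
  · have h := dotProduct_eq_sum_edgeDir hB (A s) (basicSol A (lexRhs b B₀ t.succ) B)
    simp only [row_dotProduct_basicSol hB] at h
    rw [h]
    simp only [lexRow, lexRhs, Fin.cons_succ]
    by_cases ht : t ∈ Set.range B₀
    · simp only [if_pos ht, mul_zero, Finset.sum_const_zero, neg_zero, sub_zero]
    · simp only [if_neg ht, mul_ite, mul_one, mul_zero, sub_neg_eq_add]

theorem lexRatio_eq (hB : IsUnit (A.submatrix B id).det) (b : Fin m → ℝ) (B₀ : Fin n → Fin m)
    (i : Fin n) (s : Fin m) :
    lexRatio A b B₀ B i s = toLex fun t => stepRatio A (lexRhs b B₀ t) B i s := by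
  simp only [lexRatio, lexRow_eq hB, stepRatio]

theorem lexRow_basis (hB : IsUnit (A.submatrix B id).det) (l : Fin n) :
    lexRow A b B₀ B (B l) = 0 := by
  funext t
  rw [lexRow_eq hB, row_dotProduct_basicSol hB, sub_self, Pi.zero_apply]

theorem lexRow_update (hB : IsUnit (A.submatrix B id).det) {i : Fin n} {s : Fin m}
    (hs : A s ⬝ᵥ edgeDir A B i ≠ 0) (s' : Fin m) :
    lexRow A b B₀ (Function.update B i s) s' =
      lexRow A b B₀ B s' - (A s' ⬝ᵥ edgeDir A B i) • ofLex (lexRatio A b B₀ B i s) := by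
  funext t
  simp only [lexRatio_eq hB, lexRow_eq hB, lexRow_eq (isUnit_det_update hB hs),
    basicSol_update hB _ hs, ofLex_toLex, Pi.sub_apply, Pi.smul_apply, smul_eq_mul,
    dotProduct_add, dotProduct_smul]
  ring

theorem lexRow_eq_smul_lexRatio {i : Fin n} {s : Fin m} (hs : A s ⬝ᵥ edgeDir A B i ≠ 0) :
    lexRow A b B₀ B s = (A s ⬝ᵥ edgeDir A B i) • ofLex (lexRatio A b B₀ B i s) := by
  funext t
  simp only [lexRatio, ofLex_toLex, Pi.smul_apply, smul_eq_mul]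
  rw [mul_div_cancel₀ _ hs]

/-- The slack comes first and is nonnegative; when it is zero, the only other nonzero entry is the
perturbation of `s` itself. -/
theorem lexRow_self_lexPos (hB : IsFeasibleBasis A b B) {s : Fin m} (hs : s ∉ Set.range B) :
    LexPos (lexRow A b B B s) := by
  classical
  have h0 : 0 ≤ lexRow A b B B s 0 := sub_nonneg.mpr (hB.2 s)
  have hsucc : ∀ t : Fin m, lexRow A b B B s t.succ = if s = t then 1 else 0 := by
    intro t
    simp only [lexRow, Fin.cons_succ]
    by_cases ht : t ∈ Set.range B
    · rw [if_pos ht, if_neg (by rintro rfl; exact hs ht)]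
    · rw [if_neg ht, Finset.sum_eq_zero fun l _ => if_neg fun h => ht ⟨l, h⟩, add_zero]
  rcases h0.eq_or_lt with h0 | h0
  · refine ⟨s.succ, fun j hj => ?_, by rw [hsucc, if_pos rfl]; norm_num⟩
    rcases Fin.eq_zero_or_eq_succ j with rfl | ⟨t, rfl⟩
    · exact h0.symm
    · rw [hsucc, if_neg]
      rintro rfl
      exact lt_irrefl _ hj
  · exact ⟨0, fun j hj => absurd hj (Fin.not_lt_zero j), h0⟩

/-- The lexicographic ratio test never leads to a tie. -/
theorem lexRatio_ne (hB₀ : IsUnit (A.submatrix B₀ id).det) (hB : IsUnit (A.submatrix B id).det)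
    {i : Fin n} {s s' : Fin m} (hs : Blocks A B i s) (hs' : Blocks A B i s') (hne : s ≠ s') :
    lexRatio A b B₀ B i s ≠ lexRatio A b B₀ B i s' := by
  classical
  intro heq
  have hsB := hs.notMem_range hB
  have hs'B := hs'.notMem_range hB
  have hent : ∀ t, lexRow A b B₀ B s t / (A s ⬝ᵥ edgeDir A B i) =
      lexRow A b B₀ B s' t / (A s' ⬝ᵥ edgeDir A B i) := fun t => congrFun (toLex.injective heq) t
  have hunit : ∀ r t : Fin m, t ∉ Set.range B → t ∉ Set.range B₀ →
      lexRow A b B₀ B r t.succ = if r = t then 1 else 0 := by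
    intro r t ht ht₀
    simp only [lexRow, Fin.cons_succ]
    rw [if_neg ht₀, Finset.sum_eq_zero fun l _ => if_neg fun h => ht ⟨l, h⟩, add_zero]
  -- If `s` is perturbed, its own perturbation occurs in row `s` but not in row `s'`, since `s` is
  -- not in `B`; likewise for `s'`.
  by_cases hs₀ : s ∈ Set.range B₀
  swap
  · have h := hent s.succ
    rw [hunit s s hsB hs₀, hunit s' s hsB hs₀, if_pos rfl, if_neg hne.symm, zero_div] at h
    exact div_ne_zero one_ne_zero hs.ne_zero h
  by_cases hs'₀ : s' ∈ Set.range B₀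
  swap
  · have h := hent s'.succ
    rw [hunit s s' hs'B hs'₀, hunit s' s' hs'B hs'₀, if_pos rfl, if_neg hne, zero_div] at h
    exact div_ne_zero one_ne_zero hs'.ne_zero h.symm
  set α := (A s ⬝ᵥ edgeDir A B i)⁻¹ with hα
  set α' := (A s' ⬝ᵥ edgeDir A B i)⁻¹ with hα'
  set g : Fin n → ℝ := α • A s - α' • A s' with hg
  have hgu : ∀ l, B l ∉ Set.range B₀ → g ⬝ᵥ edgeDir A B l = 0 := by
    intro l hl
    have hrow : ∀ r ∈ Set.range B₀, lexRow A b B₀ B r (B l).succ = A r ⬝ᵥ edgeDir A B l := by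
      intro r hr
      simp only [lexRow, Fin.cons_succ]
      rw [if_neg hl, if_neg (by rintro rfl; exact hl hr), zero_add]
      simp [(injective_of_isUnit_det hB).eq_iff]
    have h := hent (B l).succ
    rw [hrow s hs₀, hrow s' hs'₀, div_eq_inv_mul, div_eq_inv_mul] at h
    rw [hg, sub_dotProduct, smul_dotProduct, smul_dotProduct, smul_eq_mul, smul_eq_mul,
      sub_eq_zero]
    exact h
  obtain ⟨l₀, rfl⟩ := hs₀
  obtain ⟨l₁, rfl⟩ := hs'₀
  have h1 : g ⬝ᵥ edgeDir A B₀ l₀ = -α := by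
    have : l₁ ≠ l₀ := fun h => hne (by rw [h])
    rw [hg, sub_dotProduct, smul_dotProduct, smul_dotProduct, row_dotProduct_edgeDir hB₀,
      row_dotProduct_edgeDir hB₀, if_pos rfl, if_neg this]
    simp
  have h2 : g ⬝ᵥ edgeDir A B₀ l₀ = 0 := by
    rw [dotProduct_eq_sum_edgeDir hB, neg_eq_zero]
    refine Finset.sum_eq_zero fun l _ => ?_
    by_cases hl : B l ∈ Set.range B₀
    · obtain ⟨l', hl'⟩ := hl
      rw [← hl', row_dotProduct_edgeDir hB₀, if_neg, mul_zero]
      rintro rfl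
      exact hsB ⟨l, hl'.symm⟩
    · rw [hgu l hl, zero_mul]
  rw [h2] at h1
  exact inv_ne_zero hs.ne_zero (neg_eq_zero.mp h1.symm)

theorem exists_lexRatio_lt (hB₀ : IsUnit (A.submatrix B₀ id).det) (hB : IsFeasibleBasis A b B)
    (hbdd : Bornology.IsBounded (polyhedron A b)) (i : Fin n) :
    ∃ s, Blocks A B i s ∧
      ∀ s', Blocks A B i s' → s' ≠ s → lexRatio A b B₀ B i s < lexRatio A b B₀ B i s' := by
  classical
  obtain ⟨s₀, hs₀⟩ := exists_blocks hB hbdd i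
  obtain ⟨s, hs, hmin⟩ := (Finset.univ.filter fun s => Blocks A B i s).exists_min_image
    (lexRatio A b B₀ B i) ⟨s₀, by simpa using hs₀⟩
  simp only [Finset.mem_filter, Finset.mem_univ, true_and] at hs hmin
  exact ⟨s, hs, fun s' hs' hne =>
    lt_of_le_of_ne (hmin s' hs') (lexRatio_ne hB₀ hB.1 hs hs' hne.symm)⟩

/-- The lexicographic form of the statement that a ratio test preserves feasibility. The leaving row
receives the ratio itself, a blocking row a positive multiple of a strict difference of ratios, and
any other row gains a nonnegative multiple of the ratio. -/
theorem lexPos_lexRow_update (hB : IsUnit (A.submatrix B id).det)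
    (hlex : ∀ r ∉ Set.range B, LexPos (lexRow A b B₀ B r)) {i : Fin n} {s : Fin m}
    (hs : Blocks A B i s)
    (hmin : ∀ s', Blocks A B i s' → s' ≠ s → lexRatio A b B₀ B i s < lexRatio A b B₀ B i s') :
    LexPos (ofLex (lexRatio A b B₀ B i s)) ∧
    ∀ r ∉ Set.range (Function.update B i s), LexPos (lexRow A b B₀ (Function.update B i s) r) := by
  have hratio : LexPos (ofLex (lexRatio A b B₀ B i s)) := by
    have h := (hlex s (hs.notMem_range hB)).smul (inv_pos.mpr hs)
    rwa [lexRow_eq_smul_lexRatio hs.ne_zero, smul_smul, inv_mul_cancel₀ hs.ne_zero, one_smul] at h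
  refine ⟨hratio, fun r hr => ?_⟩
  rw [lexRow_update hB hs.ne_zero]
  by_cases hrB : r ∈ Set.range B
  · rw [← eq_of_notMem_range_update hrB hr, lexRow_basis hB, row_dotProduct_edgeDir hB, if_pos rfl]
    simpa using hratio
  by_cases hrb : Blocks A B i r
  · have hne : r ≠ s := by
      rintro rfl
      exact hr ⟨i, Function.update_self _ _ _⟩
    rw [lexRow_eq_smul_lexRatio hrb.ne_zero, ← smul_sub]
    exact (toLex_lt_toLex_iff.mp (hmin r hrb hne)).smul hrb
  · rw [sub_eq_add_neg, ← neg_smul]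
    exact (hlex r hrB).add_smul hratio (neg_nonneg.mpr (not_lt.mp hrb))

/-- The objective value of the symbolically perturbed problem. -/
noncomputable def lexObjective (A : Matrix (Fin m) (Fin n) ℝ) (b : Fin m → ℝ) (w : Fin n → ℝ)
    (B₀ B : Fin n → Fin m) : Fin (m + 1) → ℝ :=
  fun t => w ⬝ᵥ basicSol A (lexRhs b B₀ t) B

/-- The gain is the reduced cost times the lexicographic ratio. It is positive even for a degenerate
pivot, which is what rules out cycling. -/
theorem lexObjective_lt_update (hB : IsUnit (A.submatrix B id).det) {w : Fin n → ℝ} {i : Fin n}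
    {s : Fin m} (hs : Blocks A B i s) (hw : 0 < w ⬝ᵥ edgeDir A B i)
    (hratio : LexPos (ofLex (lexRatio A b B₀ B i s))) :
    toLex (lexObjective A b w B₀ B) < toLex (lexObjective A b w B₀ (Function.update B i s)) := by
  rw [toLex_lt_toLex_iff]
  convert hratio.smul hw using 1
  funext t
  simp only [lexObjective, Pi.sub_apply, Pi.smul_apply, smul_eq_mul, lexRatio_eq hB, ofLex_toLex,
    basicSol_update hB _ hs.ne_zero, dotProduct_add, dotProduct_smul]
  ring

end LexRatio

/-! ### The shadow pivot rule -/

section Shadow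

variable {m n : ℕ} {A : Matrix (Fin m) (Fin n) ℝ} {b : Fin m → ℝ} {E : Finset (Fin m)}
  {w a : Fin n → ℝ} {B₀ B : Fin n → Fin m}

/-- The state of a run of the shadow pivot rule: `B` is a lexicographically feasible basis that is
optimal for the objective `w - μ a` for some `μ ≥ 0`. -/
structure IsShadowState (A : Matrix (Fin m) (Fin n) ℝ) (b : Fin m → ℝ) (E : Finset (Fin m))
    (w a : Fin n → ℝ) (B₀ B : Fin n → Fin m) : Prop where
  feasible : IsFeasibleBasis A b B
  face : ∀ r ∈ E, r ∈ Set.range B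
  lex : ∀ r ∉ Set.range B, LexPos (lexRow A b B₀ B r)
  parametric : ∃ μ : ℝ, 0 ≤ μ ∧ ∀ l, B l ∉ E → w ⬝ᵥ edgeDir A B l ≤ μ * (a ⬝ᵥ edgeDir A B l)

theorem exists_shadow_direction
    (hμ : ∃ μ : ℝ, 0 ≤ μ ∧ ∀ l, B l ∉ E → w ⬝ᵥ edgeDir A B l ≤ μ * (a ⬝ᵥ edgeDir A B l))
    (hopt : ¬ IsOptimalBasis A E w B) :
    ∃ i, B i ∉ E ∧ 0 < w ⬝ᵥ edgeDir A B i ∧ 0 < a ⬝ᵥ edgeDir A B i ∧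
      (∀ i', B i' ∉ E → 0 < a ⬝ᵥ edgeDir A B i' →
        shadowSlope A w a B i' < shadowSlope A w a B i ∨
          (shadowSlope A w a B i' = shadowSlope A w a B i ∧ B i ≤ B i')) ∧
      ∀ l, B l ∉ E → w ⬝ᵥ edgeDir A B l ≤ shadowSlope A w a B i * (a ⬝ᵥ edgeDir A B l) := by
  classical
  obtain ⟨μ, hμ0, hμ⟩ := hμ
  unfold IsOptimalBasis at hopt
  push Not at hopt
  obtain ⟨i₀, hi₀E, hi₀⟩ := hopt
  -- A positive `w`-value is at most `μ` times the `a`-value, so the latter is positive: improving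
  -- directions are admissible for the shadow rule.
  have ha₀ : 0 < a ⬝ᵥ edgeDir A B i₀ := by
    by_contra h
    have := hμ i₀ hi₀E
    nlinarith
  obtain ⟨i, hi, himin⟩ := (Finset.univ.filter fun i =>
    B i ∉ E ∧ 0 < a ⬝ᵥ edgeDir A B i).exists_min_image
      (fun i => toLex (-shadowSlope A w a B i, B i)) ⟨i₀, by simpa using ⟨hi₀E, ha₀⟩⟩
  simp only [Finset.mem_filter, Finset.mem_univ, true_and] at hi himin
  have hmax : ∀ i', B i' ∉ E → 0 < a ⬝ᵥ edgeDir A B i' →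
      shadowSlope A w a B i' < shadowSlope A w a B i ∨
        (shadowSlope A w a B i' = shadowSlope A w a B i ∧ B i ≤ B i') := by
    intro i' h1 h2
    rcases Prod.Lex.le_iff.mp (himin i' ⟨h1, h2⟩) with h | ⟨h, h'⟩
    · exact Or.inl (neg_lt_neg_iff.mp h)
    · exact Or.inr ⟨(neg_inj.mp h).symm, h'⟩
  have hle : ∀ i', B i' ∉ E → 0 < a ⬝ᵥ edgeDir A B i' →
      shadowSlope A w a B i' ≤ shadowSlope A w a B i := by
    intro i' h1 h2
    rcases hmax i' h1 h2 with h | h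
    · exact h.le
    · exact h.1.le
  have hslope : w ⬝ᵥ edgeDir A B i = shadowSlope A w a B i * (a ⬝ᵥ edgeDir A B i) := by
    rw [shadowSlope, div_mul_cancel₀ _ hi.2.ne']
  have hpos : 0 < shadowSlope A w a B i := (div_pos hi₀ ha₀).trans_le (hle i₀ hi₀E ha₀)
  refine ⟨i, hi.1, by rw [hslope]; exact mul_pos hpos hi.2, hi.2, hmax, fun l hl => ?_⟩
  -- The maximal slope is the new parameter. Where `a` increases, this is maximality; elsewhere the
  -- bound with `μ` passes to the slope, as the slope is at most `μ` and the `a`-value is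
  -- nonpositive.
  rcases lt_or_ge 0 (a ⬝ᵥ edgeDir A B l) with h | h
  · have := hle l hl h
    rw [shadowSlope, div_le_iff₀ h] at this
    exact this
  · refine (hμ l hl).trans (mul_le_mul_of_nonpos_right ?_ h)
    rw [shadowSlope, div_le_iff₀ hi.2]
    exact hμ i hi.1

/-- At the critical parameter the entering direction has reduced cost 0 for `w - μ a`, and new
directions differ from old ones by multiples of it, so the remaining reduced costs of `w - μ a` do
not change. -/
theorem parametric_update (hB : IsUnit (A.submatrix B id).det) {i : Fin n} {s : Fin m} {μ : ℝ}
    (hs : A s ⬝ᵥ edgeDir A B i ≠ 0) (hi : w ⬝ᵥ edgeDir A B i = μ * (a ⬝ᵥ edgeDir A B i))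
    (hμ : ∀ l, B l ∉ E → w ⬝ᵥ edgeDir A B l ≤ μ * (a ⬝ᵥ edgeDir A B l)) (l : Fin n)
    (hl : Function.update B i s l ∉ E) :
    w ⬝ᵥ edgeDir A (Function.update B i s) l ≤
      μ * (a ⬝ᵥ edgeDir A (Function.update B i s) l) := by
  by_cases h : l = i
  · subst h
    rw [edgeDir_update_self hB hs, dotProduct_smul, dotProduct_smul, hi]
    simp only [smul_eq_mul]
    exact le_of_eq (by ring)
  · rw [Function.update_of_ne h] at hl
    rw [edgeDir_update_of_ne hB hs h, dotProduct_sub, dotProduct_sub, dotProduct_smul,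
      dotProduct_smul, hi]
    simp only [smul_eq_mul]
    linarith [hμ l hl]

theorem IsShadowState.exists_pivot (hB₀ : IsUnit (A.submatrix B₀ id).det)
    (hbdd : Bornology.IsBounded (polyhedron A b)) (hB : IsShadowState A b E w a B₀ B)
    (hopt : ¬ IsOptimalBasis A E w B) :
    ∃ i s, IsShadowPivot A b E w a B₀ B i s ∧
      IsShadowState A b E w a B₀ (Function.update B i s) := by
  obtain ⟨i, hiE, hwi, hai, hmax, hle⟩ := exists_shadow_direction hB.parametric hopt
  obtain ⟨s, hs, hmin⟩ := exists_lexRatio_lt (b := b) hB₀ hB.feasible hbdd i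
  have hpiv : IsPivot A b E w B i s := by
    refine ⟨hiE, hwi, hs, fun s' hs' => ?_⟩
    by_cases h : s' = s
    · rw [h]
    · have h1 := hmin s' hs' h
      rw [lexRatio_eq hB.feasible.1, lexRatio_eq hB.feasible.1] at h1
      exact apply_zero_le_of_toLex_lt h1
  refine ⟨i, s, ⟨hpiv, hai, hmax, hmin⟩, hpiv.isFeasibleBasis hB.feasible,
    mem_range_update_of_mem hiE hB.face, (lexPos_lexRow_update hB.feasible.1 hB.lex hs hmin).2,
    shadowSlope A w a B i, (div_pos hwi hai).le, ?_⟩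
  exact parametric_update hB.feasible.1 hs.ne_zero
    (by rw [shadowSlope, div_mul_cancel₀ _ hai.ne']) hle

/-- The Simplex method with the shadow pivot rule terminates at an optimal basis. -/
theorem exists_shadow_run (hbdd : Bornology.IsBounded (polyhedron A b))
    (hB : IsFeasibleBasis A b B) (hE : ∀ r ∈ E, r ∈ Set.range B)
    (hμ : ∃ μ : ℝ, 0 ≤ μ ∧ ∀ l, B l ∉ E → w ⬝ᵥ edgeDir A B l ≤ μ * (a ⬝ᵥ edgeDir A B l)) :
    ∃ (L : ℕ) (f : ℕ → Fin n → Fin m), f 0 = B ∧ IsOptimalBasis A E w (f L) ∧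
      ∀ p < L, ∃ i s, IsShadowPivot A b E w a B (f p) i s ∧
        f (p + 1) = Function.update (f p) i s := by
  refine exists_run_of_acyclic
    (R := fun C C' => ∃ i s, IsShadowPivot A b E w a B C i s ∧ C' = Function.update C i s)
    (Opt := IsOptimalBasis A E w) (Inv := IsShadowState A b E w a B) ?_ ?_ B
    ⟨hB, hE, fun r hr => lexRow_self_lexPos hB hr, hμ⟩
  · intro C hC hopt
    obtain ⟨i, s, h, h'⟩ := hC.exists_pivot hB.1 hbdd hopt
    exact ⟨_, ⟨i, s, h, rfl⟩, h'⟩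
  · intro f hf p q hpq heq
    have hmono : StrictMono fun r => toLex (lexObjective A b w B (f r)) := by
      refine strictMono_nat_of_lt_succ fun r => ?_
      obtain ⟨hst, i, s, h, hupd⟩ := hf r
      rw [hupd]
      exact lexObjective_lt_update hst.feasible.1 h.1.2.2.1 h.1.2.1
        (lexPos_lexRow_update hst.feasible.1 hst.lex h.1.2.2.1 h.2.2.2).1
    exact (hmono hpq).ne (by simp only [heq])

end Shadow

/-! ### Partial executions of the algorithm -/

/-- `T` records the first `N` linear programs of an execution. -/
structure IsExecutionUpTo {m n : ℕ} (A : Matrix (Fin m) (Fin n) ℝ) (b : Fin m → ℝ) (k : ℕ)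
    (c : Fin n → ℝ) (B₀ : Fin n → Fin m) (T : SimplexTrace m n) (N : ℕ) : Prop where
  start_zero : T.start 0 = 0
  start_le : ∀ q, q < N → T.start q ≤ T.start (q + 1)
  basis_zero : T.basis 0 = B₀
  face_zero : T.face 0 = ∅
  face_succ : ∀ q, q + 1 < n → q + 1 < N →
    T.face (q + 1) = nextFace A (T.face q) (T.obj q) (T.basis (T.start (q + 1)))
  face_back : ∀ q, n ≤ q → q < N → T.face q = T.face (2 * n - 1 - q)
  obj_first : ∀ q, q < n → q < N →
    IsNextObjective k (basicSol A b (T.basis (T.start q))) (fun j => ∃ p < q, T.obj p j ≠ 0)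
      (T.obj q)
  obj_back : ∀ q, n ≤ q → q < N → T.obj q = c
  optimal : ∀ q, q < N → IsOptimalBasis A (T.face q) (T.obj q) (T.basis (T.start (q + 1)))
  bland : ∀ q, q < n → q < N → ∀ p, T.start q ≤ p → p < T.start (q + 1) →
    ∃ i s, IsBlandPivot A b (T.face q) (T.obj q) (T.basis p) i s ∧
      T.basis (p + 1) = Function.update (T.basis p) i s
  shadow : ∀ q, n ≤ q → q < N → ∀ p, T.start q ≤ p → p < T.start (q + 1) →
    ∃ i s, IsShadowPivot A b (T.face q) (T.obj q) (-T.obj (2 * n - 1 - q))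
        (T.basis (T.start q)) (T.basis p) i s ∧
      T.basis (p + 1) = Function.update (T.basis p) i s

/-- The index sets of the faces met in the first half of the algorithm, including the one on which
the last of the objectives `±e_j` is maximal. -/
noncomputable def traceFace {m n : ℕ} (A : Matrix (Fin m) (Fin n) ℝ) (T : SimplexTrace m n) :
    ℕ → Finset (Fin m)
  | 0 => ∅
  | q + 1 => nextFace A (traceFace A T q) (T.obj q) (T.basis (T.start (q + 1)))

section Execution

variable {m n k N : ℕ} {A : Matrix (Fin m) (Fin n) ℝ} {b : Fin m → ℝ} {c : Fin n → ℝ}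
  {B₀ : Fin n → Fin m} {T : SimplexTrace m n}

theorem isExecution_iff :
    IsExecution A b k c B₀ T ↔ IsExecutionUpTo A b k c B₀ T (2 * n) := by
  constructor
  · intro h
    exact ⟨h.start_zero, h.start_le, h.basis_zero, h.face_zero, fun q hq _ => h.face_succ q hq,
      h.face_back, fun q hq _ => h.obj_first q hq, h.obj_back, h.optimal,
      fun q hq _ => h.bland q hq, h.shadow⟩
  · intro h
    exact ⟨h.start_zero, h.start_le, h.basis_zero, h.face_zero,
      fun q hq => h.face_succ q hq (by omega), h.face_back, fun q hq => h.obj_first q hq (by omega),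
      h.obj_back, h.optimal, fun q hq => h.bland q hq (by omega), h.shadow⟩

theorem IsNextObjective.exists_single {v : Fin n → ℝ} {used : Fin n → Prop} {w : Fin n → ℝ}
    (h : IsNextObjective k v used w) :
    ∃ j, ¬ used j ∧ ∃ ε : ℝ, ε ≠ 0 ∧ w = Pi.single j ε := by
  obtain ⟨j, hj, -, hw⟩ := h
  exact ⟨j, hj, _, by split_ifs <;> norm_num, hw⟩

theorem exists_isNextObjective (k : ℕ) (v : Fin n → ℝ) {used : Fin n → Prop}
    (h : ∃ j, ¬ used j) : ∃ w, IsNextObjective k v used w := by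
  classical
  obtain ⟨j₀, hj₀⟩ := h
  obtain ⟨j, hj, hmin⟩ := (Finset.univ.filter fun j => ¬ used j).exists_min_image
    (fun j => toLex (endDist k v j, j)) ⟨j₀, by simpa using hj₀⟩
  simp only [Finset.mem_filter, Finset.mem_univ, true_and] at hj hmin
  exact ⟨_, j, hj, fun j' hj' => Prod.Lex.le_iff.mp (hmin j' hj'), rfl⟩

theorem traceFace_mono (A : Matrix (Fin m) (Fin n) ℝ) (T : SimplexTrace m n) :
    Monotone (traceFace A T) :=
  monotone_nat_of_le_succ fun _ _ hr => mem_nextFace.mpr (Or.inl hr)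

namespace IsExecutionUpTo

theorem start_mono (h : IsExecutionUpTo A b k c B₀ T N) {p q : ℕ} (hpq : p ≤ q) (hq : q ≤ N) :
    T.start p ≤ T.start q := by
  refine Nat.le_induction (P := fun q _ => q ≤ N → T.start p ≤ T.start q) (fun _ => le_rfl) ?_ q
    hpq hq
  intro q _ ih hq
  exact (ih (by omega)).trans (h.start_le q (by omega))

theorem face_eq (h : IsExecutionUpTo A b k c B₀ T N) {q : ℕ} (hqn : q < n) (hqN : q < N) :
    T.face q = traceFace A T q := by
  induction q with
  | zero => exact h.face_zero
  | succ q ih => rw [h.face_succ q hqn hqN, ih (by omega) (by omega), traceFace]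

theorem face_back_eq (h : IsExecutionUpTo A b k c B₀ T N) (hN : N ≤ 2 * n) {q : ℕ} (hqn : n ≤ q)
    (hqN : q < N) : T.face q = traceFace A T (2 * n - 1 - q) := by
  rw [h.face_back q hqn hqN, h.face_eq (by omega) (by omega)]

theorem pivot (h : IsExecutionUpTo A b k c B₀ T N) {q p : ℕ} (hqN : q < N)
    (hp : T.start q ≤ p) (hp' : p < T.start (q + 1)) :
    ∃ i s, IsPivot A b (T.face q) (T.obj q) (T.basis p) i s ∧
      T.basis (p + 1) = Function.update (T.basis p) i s := by
  rcases lt_or_ge q n with hq | hq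
  · obtain ⟨i, s, h1, h2⟩ := h.bland q hq hqN p hp hp'
    exact ⟨i, s, h1.1, h2⟩
  · obtain ⟨i, s, h1, h2⟩ := h.shadow q hq hqN p hp hp'
    exact ⟨i, s, h1.1, h2⟩

theorem exists_segment (h : IsExecutionUpTo A b k c B₀ T N) {p : ℕ} (hp : p < T.start N) :
    ∃ q < N, T.start q ≤ p ∧ p < T.start (q + 1) := by
  obtain ⟨q, -, h2, h3, h4⟩ := exists_last_of_not (P := fun q => T.start q ≤ p) (Nat.zero_le N)
    (by rw [h.start_zero]; exact Nat.zero_le p) (not_le.mpr hp)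
  exact ⟨q, h2, h3, not_le.mp h4⟩

theorem isFeasibleBasis (h : IsExecutionUpTo A b k c B₀ T N) (hB₀ : IsFeasibleBasis A b B₀)
    {p : ℕ} (hp : p ≤ T.start N) : IsFeasibleBasis A b (T.basis p) := by
  induction p with
  | zero => rwa [h.basis_zero]
  | succ p ih =>
    obtain ⟨q, hq, h1, h2⟩ := h.exists_segment (p := p) (by omega)
    obtain ⟨i, s, h3, h4⟩ := h.pivot hq h1 h2
    rw [h4]
    exact h3.isFeasibleBasis (ih (by omega))

theorem isFeasibleBasis_start (h : IsExecutionUpTo A b k c B₀ T N)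
    (hB₀ : IsFeasibleBasis A b B₀) {q : ℕ} (hq : q ≤ N) :
    IsFeasibleBasis A b (T.basis (T.start q)) :=
  h.isFeasibleBasis hB₀ (h.start_mono hq le_rfl)

theorem face_subset_range_of_start (h : IsExecutionUpTo A b k c B₀ T N) {q : ℕ} (hqN : q < N)
    (hE : ∀ r ∈ T.face q, r ∈ Set.range (T.basis (T.start q))) {p : ℕ} (hp : T.start q ≤ p)
    (hp' : p ≤ T.start (q + 1)) : ∀ r ∈ T.face q, r ∈ Set.range (T.basis p) := by
  refine Nat.le_induction
    (P := fun p _ => p ≤ T.start (q + 1) → ∀ r ∈ T.face q, r ∈ Set.range (T.basis p))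
    (fun _ => hE) ?_ p hp hp'
  intro p hp ih hp'
  obtain ⟨i, s, h1, h2⟩ := h.pivot hqN hp (by omega)
  rw [h2]
  exact mem_range_update_of_mem h1.1 (ih (by omega))

theorem traceFace_subset_range (h : IsExecutionUpTo A b k c B₀ T N) {q : ℕ} (hqn : q ≤ n)
    (hqN : q ≤ N) : ∀ r ∈ traceFace A T q, r ∈ Set.range (T.basis (T.start q)) := by
  induction q with
  | zero => simp [traceFace]
  | succ q ih =>
    refine nextFace_subset_range ?_
    have h1 := h.face_eq (q := q) (by omega) (by omega)
    have h2 := h.face_subset_range_of_start (q := q) (by omega)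
      (by rw [h1]; exact ih (by omega) (by omega)) (h.start_le q (by omega)) le_rfl
    rwa [h1] at h2

theorem optimal_traceFace (h : IsExecutionUpTo A b k c B₀ T N) {q : ℕ} (hqn : q < n)
    (hqN : q < N) :
    IsOptimalBasis A (traceFace A T q) (T.obj q) (T.basis (T.start (q + 1))) := by
  rw [← h.face_eq hqn hqN]
  exact h.optimal q hqN

/-- The dual multipliers found in the first half of the algorithm. -/
theorem exists_certificate (h : IsExecutionUpTo A b k c B₀ T N) (hB₀ : IsFeasibleBasis A b B₀)
    {q : ℕ} (hqn : q < n) (hqN : q < N) :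
    ∃ y : Fin m → ℝ, T.obj q = ∑ r, y r • A r ∧ (∀ r, y r ≠ 0 → r ∈ traceFace A T (q + 1)) ∧
      ∀ r ∈ traceFace A T (q + 1), r ∉ traceFace A T q → 0 < y r :=
  exists_multipliers_nextFace (h.isFeasibleBasis_start hB₀ (q := q + 1) (by omega)).1
    (h.optimal_traceFace hqn hqN)

/-- In the first half every coordinate is dealt with. -/
theorem exists_obj_eq_single (h : IsExecutionUpTo A b k c B₀ T N) (hN : n ≤ N) (j : Fin n) :
    ∃ q < n, ∃ ε : ℝ, ε ≠ 0 ∧ T.obj q = Pi.single j ε := by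
  have hex : ∀ q : Fin n, ∃ j, (¬ ∃ p < (q : ℕ), T.obj p j ≠ 0) ∧
      ∃ ε : ℝ, ε ≠ 0 ∧ T.obj q = Pi.single j ε := fun q =>
    (h.obj_first q q.2 (by omega)).exists_single
  choose J hJ ε hε hobj using hex
  have hlt : ∀ p q : Fin n, p < q → J p ≠ J q := by
    intro p q hpq heq
    refine hJ q ⟨p, hpq, ?_⟩
    rw [hobj p, ← heq, Pi.single_eq_same]
    exact hε p
  have hinj : Function.Injective J := by
    intro p q heq
    rcases lt_trichotomy p q with h | h | h
    · exact absurd heq (hlt p q h)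
    · exact h
    · exact absurd heq.symm (hlt q p h)
  obtain ⟨q, rfl⟩ := (Finite.injective_iff_surjective.mp hinj) j
  exact ⟨q, q.2, ε q, hε q, hobj q⟩

/-- Each objective `±e_j` involves a single coordinate, so fewer than `n` of them cannot cover all.
-/
theorem exists_unused (h : IsExecutionUpTo A b k c B₀ T N) (hN : N < n) :
    ∃ j, ¬ ∃ p < N, T.obj p j ≠ 0 := by
  by_contra! hall
  choose p hp hne using hall
  have hsingle : ∀ j, ∃ ε : ℝ, T.obj (p j) = Pi.single j ε := by
    intro j
    obtain ⟨j', -, ε, -, hobj⟩ := (h.obj_first (p j) ((hp j).trans hN) (hp j)).exists_single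
    have hj := hne j
    rw [hobj] at hj
    have : j = j' := by
      by_contra hjj
      exact hj (Pi.single_eq_of_ne hjj _)
    subst this
    exact ⟨ε, hobj⟩
  have hinj : Function.Injective fun j => (⟨p j, hp j⟩ : Fin N) := by
    intro j j' heq
    have heq : p j = p j' := congrArg Fin.val heq
    obtain ⟨ε, hε⟩ := hsingle j
    by_contra hjj
    have := hne j'
    rw [← heq, hε] at this
    exact this (Pi.single_eq_of_ne (Ne.symm hjj) _)
  have := Fintype.card_le_of_injective _ hinj
  simp only [Fintype.card_fin] at this
  omega

/-- After the first half all inequalities of the basis are turned into equations. -/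
theorem basis_mem_traceFace (h : IsExecutionUpTo A b k c B₀ T N) (hB₀ : IsFeasibleBasis A b B₀)
    (hN : n ≤ N) (l : Fin n) : T.basis (T.start n) l ∈ traceFace A T n := by
  by_contra hl
  have hB := (h.isFeasibleBasis_start hB₀ hN).1
  -- All earlier objectives are combinations of rows in the final face. A basis row outside it would
  -- have an edge direction orthogonal to all of them, hence to every `e_j`.
  refine edgeDir_ne_zero hB l (funext fun j => ?_)
  obtain ⟨q, hq, ε, hε, hobj⟩ := h.exists_obj_eq_single hN j
  obtain ⟨y, hy, hsupp, -⟩ := h.exists_certificate hB₀ hq (by omega)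
  have hsupp' : ∀ r, y r ≠ 0 → r ∈ traceFace A T n := fun r hr =>
    traceFace_mono A T (by omega : q + 1 ≤ n) (hsupp r hr)
  have h1 := dotProduct_edgeDir_of_multipliers hB hy
    (fun r hr => h.traceFace_subset_range le_rfl hN r (hsupp' r hr)) l
  have h2 : y (T.basis (T.start n) l) = 0 := by
    by_contra h0
    exact hl (hsupp' _ h0)
  rw [h2, hobj, single_dotProduct, neg_zero] at h1
  exact (mul_eq_zero.mp h1).resolve_left hε

/-- The hand-over between LPs of the second half: the last basis is `c`-optimal on the face one
level below the next one. At `q = n` optimality is vacuous, because all basis rows are equations. -/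
theorem back_invariant (h : IsExecutionUpTo A b k c B₀ T N) (hB₀ : IsFeasibleBasis A b B₀)
    (hN : N ≤ 2 * n) {q : ℕ} (hqn : n ≤ q) (hqN : q ≤ N) :
    (∀ r ∈ traceFace A T (2 * n - q), r ∈ Set.range (T.basis (T.start q))) ∧
      IsOptimalBasis A (traceFace A T (2 * n - q)) c (T.basis (T.start q)) := by
  induction q, hqn using Nat.le_induction with
  | base =>
    have : 2 * n - n = n := by omega
    rw [this]
    exact ⟨h.traceFace_subset_range le_rfl hqN, fun l hl =>
      absurd (h.basis_mem_traceFace hB₀ hqN l) hl⟩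
  | succ q hqn ih =>
    have hface := h.face_back_eq hN hqn (by omega)
    have hidx : 2 * n - 1 - q = 2 * n - (q + 1) := by omega
    rw [hidx] at hface
    rw [← hface, ← h.obj_back q hqn (by omega)]
    refine ⟨h.face_subset_range_of_start (by omega) ?_ (h.start_le q (by omega)) le_rfl,
      h.optimal q (by omega)⟩
    intro r hr
    rw [hface] at hr
    exact (ih (by omega)).1 r (traceFace_mono A T (by omega) hr)

/-- At the start of each linear program of the second half the basis is optimal for all objectives
`c + μ w` with `μ` large, where `w` is the former objective. -/
theorem parametric_start (h : IsExecutionUpTo A b k c B₀ T N) (hB₀ : IsFeasibleBasis A b B₀)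
    (hN : N ≤ 2 * n) {q : ℕ} (hqn : n ≤ q) (hqN : q ≤ N) (hq : q < 2 * n) :
    ∃ μ : ℝ, 0 ≤ μ ∧ ∀ l, T.basis (T.start q) l ∉ traceFace A T (2 * n - 1 - q) →
      c ⬝ᵥ edgeDir A (T.basis (T.start q)) l ≤
        μ * (-T.obj (2 * n - 1 - q) ⬝ᵥ edgeDir A (T.basis (T.start q)) l) := by
  obtain ⟨hrange, hopt⟩ := h.back_invariant hB₀ hN hqn hqN
  obtain ⟨y, hy, hsupp, hpos⟩ :=
    h.exists_certificate hB₀ (q := 2 * n - 1 - q) (by omega) (by omega)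
  have hidx : 2 * n - 1 - q + 1 = 2 * n - q := by omega
  rw [hidx] at hsupp hpos
  have hB := (h.isFeasibleBasis_start hB₀ hqN).1
  set B := T.basis (T.start q) with hBdef
  have hred : ∀ l, -T.obj (2 * n - 1 - q) ⬝ᵥ edgeDir A B l = y (B l) := by
    intro l
    rw [neg_dotProduct, dotProduct_edgeDir_of_multipliers hB hy
      (fun r hr => hrange r (hsupp r hr)) l, neg_neg]
  have hnonneg : ∀ l, 0 ≤ |c ⬝ᵥ edgeDir A B l| / |y (B l)| := fun l => by positivity
  -- A crude upper bound for all the ratios needed; terms with `y (B l) = 0` are zero by the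
  -- convention for division.
  refine ⟨∑ l, |c ⬝ᵥ edgeDir A B l| / |y (B l)|, Finset.sum_nonneg fun l _ => hnonneg l, ?_⟩
  intro l hl
  rw [hred]
  -- Rows added in passing to the smaller face have positive multiplier and are dominated for large
  -- `μ`. The other rows have multiplier 0, and there optimality of `c` on the smaller face
  -- suffices.
  by_cases hl' : B l ∈ traceFace A T (2 * n - q)
  · have hyl := hpos _ hl' hl
    have h1 := Finset.single_le_sum (fun l _ => hnonneg l) (Finset.mem_univ l)
    rw [abs_of_pos hyl, div_le_iff₀ hyl] at h1
    exact (le_abs_self _).trans h1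
  · have : y (B l) = 0 := by
      by_contra h0
      exact hl' (hsupp _ h0)
    rw [this, mul_zero]
    exact hopt l hl'

end IsExecutionUpTo

/-! #### Existence of an execution -/

/-- Append one linear program to a trace. -/
def SimplexTrace.append (T : SimplexTrace m n) (N : ℕ) (E : Finset (Fin m)) (w : Fin n → ℝ)
    (L : ℕ) (f : ℕ → Fin n → Fin m) : SimplexTrace m n where
  face q := if q = N then E else T.face q
  obj q := if q = N then w else T.obj q
  start q := if q ≤ N then T.start q else T.start N + L
  basis p := if p ≤ T.start N then T.basis p else f (p - T.start N)

theorem IsExecutionUpTo.append (h : IsExecutionUpTo A b k c B₀ T N) {E : Finset (Fin m)}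
    {w : Fin n → ℝ} {L : ℕ} {f : ℕ → Fin n → Fin m}
    (hf0 : f 0 = T.basis (T.start N)) (hzero : N = 0 → E = ∅)
    (hsucc : ∀ q, q + 1 = N → q + 1 < n →
      E = nextFace A (T.face q) (T.obj q) (T.basis (T.start (q + 1))))
    (hback : n ≤ N → N < 2 * n ∧ E = T.face (2 * n - 1 - N))
    (hobj : N < n → IsNextObjective k (basicSol A b (T.basis (T.start N)))
      (fun j => ∃ p < N, T.obj p j ≠ 0) w)
    (hobj' : n ≤ N → w = c) (hopt : IsOptimalBasis A E w (f L))
    (hbland : N < n → ∀ p < L, ∃ i s, IsBlandPivot A b E w (f p) i s ∧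
      f (p + 1) = Function.update (f p) i s)
    (hshadow : n ≤ N → ∀ p < L, ∃ i s,
      IsShadowPivot A b E w (-T.obj (2 * n - 1 - N)) (f 0) (f p) i s ∧
      f (p + 1) = Function.update (f p) i s) :
    IsExecutionUpTo A b k c B₀ (T.append N E w L f) (N + 1) := by
  have hface : ∀ q, q ≠ N → (T.append N E w L f).face q = T.face q := fun q hq => if_neg hq
  have hfaceN : (T.append N E w L f).face N = E := if_pos rfl
  have hob : ∀ q, q ≠ N → (T.append N E w L f).obj q = T.obj q := fun q hq => if_neg hq
  have hobN : (T.append N E w L f).obj N = w := if_pos rfl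
  have hst : ∀ q, q ≤ N → (T.append N E w L f).start q = T.start q := fun q hq => if_pos hq
  have hstN : (T.append N E w L f).start (N + 1) = T.start N + L := if_neg (by omega)
  have hba : ∀ p, p ≤ T.start N → (T.append N E w L f).basis p = T.basis p := fun p hp => if_pos hp
  -- The old and the new run overlap at index `T.start N`, where they agree by `hf0`.
  have hbaN : ∀ p, (T.append N E w L f).basis (T.start N + p) = f p := by
    intro p
    rcases Nat.eq_zero_or_pos p with rfl | hp
    · rw [hf0]; exact if_pos le_rfl
    · have : (T.append N E w L f).basis (T.start N + p) = f (T.start N + p - T.start N) :=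
        if_neg (by omega)
      rw [this, Nat.add_sub_cancel_left]
  have hmono : ∀ q, q < N → T.start (q + 1) ≤ T.start N := fun q hq => h.start_mono hq le_rfl
  have hused : ∀ q ≤ N, (fun j => ∃ p < q, (T.append N E w L f).obj p j ≠ 0) =
      fun j => ∃ p < q, T.obj p j ≠ 0 := by
    intro q hq
    funext j
    refine propext (exists_congr fun p => and_congr_right fun hp => ?_)
    rw [hob p (by omega)]
  refine ⟨?_, ?_, ?_, ?_, ?_, ?_, ?_, ?_, ?_, ?_, ?_⟩
  · rw [hst 0 (Nat.zero_le N), h.start_zero]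
  · intro q hq
    rcases Nat.lt_succ_iff_lt_or_eq.mp hq with hq | rfl
    · rw [hst q hq.le, hst (q + 1) hq]; exact h.start_le q hq
    · rw [hst q le_rfl, hstN]; omega
  · rw [hba 0 (Nat.zero_le _), h.basis_zero]
  · by_cases hN : N = 0
    · subst hN; rw [hfaceN, hzero rfl]
    · rw [hface 0 (Ne.symm hN), h.face_zero]
  · intro q hqn hq
    have hqN : q + 1 ≤ N := by omega
    rw [hface q (by omega), hob q (by omega), hst (q + 1) hqN, hba _ (h.start_mono hqN le_rfl)]
    rcases hqN.eq_or_lt with hq' | hq'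
    · rw [hq', hfaceN, ← hq']; exact hsucc q hq' hqn
    · rw [hface _ hq'.ne]; exact h.face_succ q hqn hq'
  · intro q hqn hq
    rcases Nat.lt_succ_iff_lt_or_eq.mp hq with hq | rfl
    · rw [hface q hq.ne, hface _ (by omega)]; exact h.face_back q hqn hq
    · have := hback hqn
      rw [hfaceN, hface _ (by omega)]; exact this.2
  · intro q hqn hq
    rw [hused q (by omega), hst q (by omega), hba _ (h.start_mono (by omega) le_rfl)]
    rcases Nat.lt_succ_iff_lt_or_eq.mp hq with hq | rfl
    · rw [hob q hq.ne]; exact h.obj_first q hqn hq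
    · rw [hobN]; exact hobj hqn
  · intro q hqn hq
    rcases Nat.lt_succ_iff_lt_or_eq.mp hq with hq | rfl
    · rw [hob q hq.ne]; exact h.obj_back q hqn hq
    · rw [hobN]; exact hobj' hqn
  · intro q hq
    rcases Nat.lt_succ_iff_lt_or_eq.mp hq with hq | rfl
    · rw [hface q hq.ne, hob q hq.ne, hst _ hq, hba _ (hmono q hq)]
      exact h.optimal q hq
    · rw [hfaceN, hobN, hstN, hbaN]; exact hopt
  · intro q hqn hq p hp hp'
    rcases Nat.lt_succ_iff_lt_or_eq.mp hq with hq | rfl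
    · rw [hst q hq.le] at hp
      rw [hst (q + 1) hq] at hp'
      have := hmono q hq
      rw [hface q hq.ne, hob q hq.ne, hba p (by omega), hba (p + 1) (by omega)]
      exact h.bland q hqn hq p hp hp'
    · rw [hst q le_rfl] at hp
      rw [hstN] at hp'
      obtain ⟨p, rfl⟩ := Nat.exists_eq_add_of_le hp
      rw [hfaceN, hobN, hbaN, add_assoc, hbaN]
      exact hbland hqn p (by omega)
  · intro q hqn hq p hp hp'
    rcases Nat.lt_succ_iff_lt_or_eq.mp hq with hq | rfl
    · rw [hst q hq.le] at hp
      rw [hst (q + 1) hq] at hp'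
      have := hmono q hq
      rw [hface q hq.ne, hob q hq.ne, hob _ (by omega), hst q hq.le,
        hba _ (h.start_mono hq.le le_rfl), hba p (by omega), hba (p + 1) (by omega)]
      exact h.shadow q hqn hq p hp hp'
    · have := hback hqn
      rw [hst q le_rfl] at hp
      rw [hstN] at hp'
      obtain ⟨p, rfl⟩ := Nat.exists_eq_add_of_le hp
      rw [hfaceN, hobN, hob _ (by omega), hst q le_rfl, hba _ le_rfl, hbaN, add_assoc, hbaN, ← hf0]
      exact hshadow hqn p (by omega)

/-- The LPs are appended one at a time, because the start of each, and in the second half the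
invariant for the shadow rule, depends on the whole record so far. -/
theorem exists_isExecutionUpTo (k : ℕ) (c : Fin n → ℝ) (hB₀ : IsFeasibleBasis A b B₀)
    (hbdd : Bornology.IsBounded (polyhedron A b)) (N : ℕ) (hN : N ≤ 2 * n) :
    ∃ T, IsExecutionUpTo A b k c B₀ T N := by
  induction N with
  | zero =>
    exact ⟨⟨fun _ => ∅, fun _ => 0, fun _ => 0, fun _ => B₀⟩, rfl, by simp, rfl, rfl, by simp,
      by simp, by simp, by simp, by simp, by simp, by simp⟩
  | succ N ih =>
    obtain ⟨T, h⟩ := ih (by omega)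
    have hB := h.isFeasibleBasis_start hB₀ le_rfl
    rcases lt_or_ge N n with hNn | hNn
    · obtain ⟨w, hw⟩ := exists_isNextObjective k (basicSol A b (T.basis (T.start N)))
        (h.exists_unused hNn)
      obtain ⟨L, f, hf0, hopt, hrun⟩ := exists_bland_run hB
        (h.traceFace_subset_range hNn.le le_rfl) hbdd w
      refine ⟨_, h.append hf0 ?_ ?_ (fun h => absurd hNn (not_lt.mpr h)) (fun _ => hw)
        (fun h => absurd hNn (not_lt.mpr h)) hopt (fun _ => hrun)
        (fun h => absurd hNn (not_lt.mpr h))⟩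
      · rintro rfl; rfl
      · rintro q rfl _
        rw [traceFace, h.face_eq (by omega) (by omega)]
    · have hface := h.face_eq (q := 2 * n - 1 - N) (by omega) (by omega)
      obtain ⟨L, f, hf0, hopt, hrun⟩ := exists_shadow_run (a := -T.obj (2 * n - 1 - N)) hbdd hB
        (fun r hr => (h.back_invariant hB₀ (by omega) hNn le_rfl).1 r
          (traceFace_mono A T (by omega) hr))
        (h.parametric_start hB₀ (by omega) hNn le_rfl (by omega))
      refine ⟨_, h.append hf0 ?_ ?_ (fun _ => ⟨by omega, hface.symm⟩)
        (fun h => absurd h (not_lt.mpr hNn)) (fun _ => rfl) hopt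
        (fun h => absurd h (not_lt.mpr hNn)) (fun _ => by rw [hf0]; exact hrun)⟩
      · omega
      · omega

end Execution

/-! ### Walks from sequences of vertices -/

section Walk

variable {n : ℕ} {P : Set (Fin n → ℝ)}

/-- The induction removes the first point, since walks and `destutter` both recurse at the head: a
repeated first point changes neither list nor count, a new one adds an edge. -/
theorem exists_walk_destutter [DecidableRel fun y z : Fin n → ℝ => y ≠ z] (N : ℕ)
    (x : ℕ → Fin n → ℝ) [DecidablePred fun p => x p ≠ x (p + 1)]
    (hx : ∀ p ≤ N, x p ∈ P.extremePoints ℝ)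
    (hadj : ∀ p < N, IsExposed ℝ P (segment ℝ (x p) (x (p + 1)))) :
    ∃ (u v : P.extremePoints ℝ) (W : (polytopeGraph P).Walk u v),
      (u : Fin n → ℝ) = x 0 ∧ (v : Fin n → ℝ) = x N ∧
      W.support.map Subtype.val = ((List.range (N + 1)).map x).destutter (· ≠ ·) ∧
      W.length = ((Finset.range N).filter fun p => x p ≠ x (p + 1)).card := by
  classical
  induction N generalizing x with
  | zero =>
    exact ⟨⟨x 0, hx 0 le_rfl⟩, _, SimpleGraph.Walk.nil, rfl, rfl, by simp, by simp⟩
  | succ N ih =>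
    obtain ⟨u, v, W, hu, hv, hsupp, hlen⟩ := ih (fun p => x (p + 1))
      (fun p hp => hx (p + 1) (by omega)) fun p hp => hadj (p + 1) (by omega)
    have hlist : (List.range (N + 1 + 1)).map x =
        x 0 :: (List.range (N + 1)).map fun p => x (p + 1) := by
      rw [List.range_succ_eq_map, List.map_cons, List.map_map]; rfl
    have hlist' : ((List.range (N + 1)).map fun p => x (p + 1)) =
        x 1 :: (List.range N).map fun p => x (p + 2) := by
      rw [List.range_succ_eq_map, List.map_cons, List.map_map]; rfl
    have hcard : ((Finset.range (N + 1)).filter fun p => x p ≠ x (p + 1)).card =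
        ((Finset.range N).filter fun p => x (p + 1) ≠ x (p + 1 + 1)).card +
          if x 0 ≠ x 1 then 1 else 0 := by
      rw [Finset.card_filter, Finset.card_filter, Finset.sum_range_succ']
    rw [hlist, List.destutter_cons', hlist', hcard]
    rw [hlist', List.destutter_cons'] at hsupp
    by_cases h : x 0 = x 1
    · refine ⟨u, v, W, hu.trans h.symm, hv, ?_, ?_⟩
      · rw [hsupp, List.destutter'_cons_neg _ (not_not.mpr h), h]
      · rw [hlen, if_neg (not_not.mpr h), add_zero]
    · have had : (polytopeGraph P).Adj ⟨x 0, hx 0 (by omega)⟩ u := by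
        refine ⟨fun heq => h ?_, ?_⟩
        · rw [← hu, ← heq]
        · rw [hu]; exact hadj 0 (by omega)
      refine ⟨_, v, SimpleGraph.Walk.cons had W, rfl, hv, ?_, ?_⟩
      · rw [SimpleGraph.Walk.support_cons, List.map_cons, hsupp,
          List.destutter'_cons_pos _ h]
      · rw [SimpleGraph.Walk.length_cons, hlen, if_pos h]

end Walk

/-! ### Lattice polytopes -/

section Lattice

variable {n k : ℕ} {P : Set (Fin n → ℝ)}

theorem IsZeroKLatticePolytope.mem_box (hP : IsZeroKLatticePolytope k P) {x : Fin n → ℝ}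
    (hx : x ∈ P) (j : Fin n) : 0 ≤ x j ∧ x j ≤ k := by
  obtain ⟨S, -, hS, rfl⟩ := hP
  have hsub : convexHull ℝ ((fun (z : Fin n → ℤ) (j : Fin n) => (z j : ℝ)) '' S) ⊆
      Set.Icc 0 fun _ => (k : ℝ) := by
    refine convexHull_min ?_ (convex_Icc _ _)
    rintro _ ⟨z, hz, rfl⟩
    refine ⟨fun j => ?_, fun j => ?_⟩
    · simpa using (hS z hz j).1
    · have := (hS z hz j).2
      change (z j : ℝ) ≤ k
      exact_mod_cast this
  exact ⟨(hsub hx).1 j, (hsub hx).2 j⟩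

theorem IsZeroKLatticePolytope.isBounded (hP : IsZeroKLatticePolytope k P) :
    Bornology.IsBounded P :=
  (Metric.isBounded_Icc (0 : Fin n → ℝ) fun _ => (k : ℝ)).subset fun _ hx =>
    ⟨fun j => (hP.mem_box hx j).1, fun j => (hP.mem_box hx j).2⟩

theorem IsZeroKLatticePolytope.exists_int (hP : IsZeroKLatticePolytope k P) {x : Fin n → ℝ}
    (hx : x ∈ P.extremePoints ℝ) (j : Fin n) : ∃ z : ℤ, x j = z := by
  obtain ⟨S, -, -, rfl⟩ := hP
  obtain ⟨z, -, rfl⟩ := extremePoints_convexHull_subset hx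
  exact ⟨z j, rfl⟩

/-- Integrality of vertices enters the step count only here. -/
theorem IsZeroKLatticePolytope.add_one_le (hP : IsZeroKLatticePolytope k P) {x y : Fin n → ℝ}
    (hx : x ∈ P.extremePoints ℝ) (hy : y ∈ P.extremePoints ℝ) {j : Fin n} {ε : ℝ}
    (hε : ε = 1 ∨ ε = -1) (hlt : (Pi.single j ε : Fin n → ℝ) ⬝ᵥ x < Pi.single j ε ⬝ᵥ y) :
    (Pi.single j ε : Fin n → ℝ) ⬝ᵥ x + 1 ≤ Pi.single j ε ⬝ᵥ y := by
  obtain ⟨z, hz⟩ := hP.exists_int hx j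
  obtain ⟨z', hz'⟩ := hP.exists_int hy j
  rw [single_dotProduct, single_dotProduct, hz, hz'] at hlt
  rw [single_dotProduct, single_dotProduct, hz, hz']
  rcases hε with rfl | rfl
  · have : z < z' := by exact_mod_cast (by linarith : (z : ℝ) < z')
    have : (z : ℝ) + 1 ≤ z' := by exact_mod_cast this
    linarith
  · have : z' < z := by exact_mod_cast (by linarith : (z' : ℝ) < z)
    have : (z' : ℝ) + 1 ≤ z := by exact_mod_cast this
    linarith

end Lattice

/-! ### Counting steps and dimension drops -/

theorem card_filter_Ico_le {g : ℕ → ℝ} {D : ℕ → Prop} [DecidablePred D] {s e : ℕ} (hse : s ≤ e)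
    (hD : ∀ p, s ≤ p → p < e → D p → g p + 1 ≤ g (p + 1))
    (hD' : ∀ p, s ≤ p → p < e → ¬ D p → g p ≤ g (p + 1)) :
    (((Finset.Ico s e).filter D).card : ℝ) ≤ g e - g s := by
  induction e, hse using Nat.le_induction with
  | base => simp
  | succ e hse ih =>
    have ih := ih (fun p h1 h2 => hD p h1 (by omega)) fun p h1 h2 => hD' p h1 (by omega)
    rw [Finset.card_filter] at *
    rw [Finset.sum_Ico_succ_top hse]
    push_cast at *
    by_cases h : D e
    · rw [if_pos h]; linarith [hD e hse (by omega) h]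
    · rw [if_neg h]; linarith [hD' e hse (by omega) h]

/-- The functional `w` vanishes on the directions of its set of maximizers, but not on `x - y`. -/
theorem finrank_vectorSpan_maximizers_lt {n : ℕ} {F : Set (Fin n → ℝ)} {w x y : Fin n → ℝ}
    (hx : x ∈ F) (hy : y ∈ F) (hxy : w ⬝ᵥ x ≠ w ⬝ᵥ y) :
    Module.finrank ℝ (vectorSpan ℝ (maximizers F w)) < Module.finrank ℝ (vectorSpan ℝ F) := by
  refine Submodule.finrank_lt_finrank_of_lt (lt_of_le_of_ne (vectorSpan_mono ℝ fun _ h => h.1) ?_)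
  intro heq
  obtain ⟨l, hl⟩ := dotProduct_continuousLinearMap w
  have hker : vectorSpan ℝ (maximizers F w) ≤ LinearMap.ker l.toLinearMap := by
    refine Submodule.span_le.mpr ?_
    rintro _ ⟨u, hu, v, hv, rfl⟩
    have : l (u - v) = 0 := by
      rw [hl, dotProduct_sub, sub_eq_zero]
      exact le_antisymm (hv.2 u hu.1) (hu.2 v hv.1)
    simpa using this
  have h := hker (heq ▸ vsub_mem_vectorSpan ℝ hx hy)
  have h' : l (x - y) = 0 := by simpa using h
  rw [hl, dotProduct_sub, sub_eq_zero] at h'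
  exact hxy h'

/-! ### Properties of an execution -/

namespace IsExecutionUpTo

variable {m n k N : ℕ} {A : Matrix (Fin m) (Fin n) ℝ} {b : Fin m → ℝ} {c : Fin n → ℝ}
  {B₀ : Fin n → Fin m} {T : SimplexTrace m n}

theorem face_subset_range (h : IsExecutionUpTo A b k c B₀ T N) (hB₀ : IsFeasibleBasis A b B₀)
    (hN : N ≤ 2 * n) {q p : ℕ} (hq : q < N) (hp : T.start q ≤ p) (hp' : p ≤ T.start (q + 1)) :
    ∀ r ∈ T.face q, r ∈ Set.range (T.basis p) := by
  refine h.face_subset_range_of_start hq ?_ hp hp'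
  rcases lt_or_ge q n with hqn | hqn
  · rw [h.face_eq hqn hq]
    exact h.traceFace_subset_range hqn.le hq.le
  · rw [h.face_back_eq hN hqn hq]
    exact fun r hr => (h.back_invariant hB₀ hN hqn hq.le).1 r (traceFace_mono A T (by omega) hr)

theorem basicSol_mem_faceOf (h : IsExecutionUpTo A b k c B₀ T N) (hB₀ : IsFeasibleBasis A b B₀)
    (hN : N ≤ 2 * n) {q p : ℕ} (hq : q < N) (hp : T.start q ≤ p) (hp' : p ≤ T.start (q + 1)) :
    basicSol A b (T.basis p) ∈ faceOf A b (T.face q) :=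
  _root_.basicSol_mem_faceOf (h.isFeasibleBasis hB₀ (hp'.trans (h.start_mono hq le_rfl)))
    (h.face_subset_range hB₀ hN hq hp hp')

theorem basicSol_mem_maximizers (h : IsExecutionUpTo A b k c B₀ T N)
    (hB₀ : IsFeasibleBasis A b B₀) (hN : N ≤ 2 * n) {q : ℕ} (hq : q < N) :
    basicSol A b (T.basis (T.start (q + 1))) ∈ maximizers (faceOf A b (T.face q)) (T.obj q) :=
  _root_.basicSol_mem_maximizers (h.isFeasibleBasis_start hB₀ hq)
    (h.face_subset_range hB₀ hN hq (h.start_le q hq) le_rfl) (h.optimal q hq)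

theorem faceOf_traceFace_succ (h : IsExecutionUpTo A b k c B₀ T N)
    (hB₀ : IsFeasibleBasis A b B₀) (hN : N ≤ 2 * n) {q : ℕ} (hqn : q < n) (hq : q < N) :
    faceOf A b (traceFace A T (q + 1)) =
      maximizers (faceOf A b (traceFace A T q)) (T.obj q) := by
  have hr := h.face_subset_range hB₀ hN hq (h.start_le q hq) le_rfl
  rw [h.face_eq hqn hq] at hr
  exact faceOf_nextFace (h.isFeasibleBasis_start hB₀ hq) hr (h.optimal_traceFace hqn hq)

theorem result_mem_maximizers (h : IsExecutionUpTo A b k c B₀ T (2 * n))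
    (hB₀ : IsFeasibleBasis A b B₀) : T.result A b ∈ maximizers (polyhedron A b) c := by
  -- For `n = 0` there is no LP, and the objective is trivially constant. Otherwise the last LP is
  -- over the whole polyhedron.
  rcases Nat.eq_zero_or_pos n with rfl | hn
  · exact ⟨(h.isFeasibleBasis_start hB₀ le_rfl).2, fun y _ => by simp⟩
  · have h1 := h.basicSol_mem_maximizers hB₀ le_rfl (q := 2 * n - 1) (by omega)
    have hidx : 2 * n - 1 + 1 = 2 * n := by omega
    have hidx' : 2 * n - 1 - (2 * n - 1) = 0 := by omega
    rw [hidx, h.face_back_eq le_rfl (by omega) (by omega), h.obj_back _ (by omega) (by omega),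
      hidx', traceFace, faceOf_empty] at h1
    exact h1

/-- The objective of the `q`-th linear program of the first half is not constant on its face. -/
def NonconstantAt (A : Matrix (Fin m) (Fin n) ℝ) (b : Fin m → ℝ) (T : SimplexTrace m n)
    (q : ℕ) : Prop :=
  ∃ x ∈ faceOf A b (traceFace A T q), ∃ y ∈ faceOf A b (traceFace A T q),
    T.obj q ⬝ᵥ x ≠ T.obj q ⬝ᵥ y

theorem card_nonconstant_add_finrank_le [DecidablePred (NonconstantAt A b T)]
    (h : IsExecutionUpTo A b k c B₀ T N)
    (hB₀ : IsFeasibleBasis A b B₀) (hN : N ≤ 2 * n) {q : ℕ} (hqn : q ≤ n) (hq : q ≤ N) :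
    ((Finset.range q).filter (NonconstantAt A b T)).card +
      Module.finrank ℝ (vectorSpan ℝ (faceOf A b (traceFace A T q))) ≤
        Module.finrank ℝ (vectorSpan ℝ (polyhedron A b)) := by
  induction q with
  | zero => rw [traceFace, faceOf_empty]; simp
  | succ q ih =>
    have ih := ih (by omega) (by omega)
    rw [h.faceOf_traceFace_succ hB₀ hN hqn hq, Finset.range_add_one, Finset.filter_insert]
    split_ifs with hc
    · obtain ⟨x, hx, y, hy, hxy⟩ := hc
      have := finrank_vectorSpan_maximizers_lt hx hy hxy
      rw [Finset.card_insert_of_notMem (by simp)]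
      omega
    · have : Module.finrank ℝ (vectorSpan ℝ (maximizers (faceOf A b (traceFace A T q)) (T.obj q))) ≤
          Module.finrank ℝ (vectorSpan ℝ (faceOf A b (traceFace A T q))) :=
        Submodule.finrank_mono (vectorSpan_mono ℝ fun _ h => h.1)
      omega

/-- The number of nondegenerate steps of a linear program is bounded by the increase of an integral
objective that all of its pivots improve. -/
theorem card_nondegenerate_le (h : IsExecutionUpTo A b k c B₀ T N)
    (hP : IsZeroKLatticePolytope k (polyhedron A b)) (hB₀ : IsFeasibleBasis A b B₀) {q : ℕ}
    (hq : q < N) {j : Fin n} {ε : ℝ} (hε : ε = 1 ∨ ε = -1)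
    [DecidablePred fun p => basicSol A b (T.basis p) ≠ basicSol A b (T.basis (p + 1))]
    (himp : ∀ p, T.start q ≤ p → p < T.start (q + 1) →
      ∃ i s, Blocks A (T.basis p) i s ∧
        0 < (Pi.single j ε : Fin n → ℝ) ⬝ᵥ edgeDir A (T.basis p) i ∧
        T.basis (p + 1) = Function.update (T.basis p) i s) :
    (((Finset.Ico (T.start q) (T.start (q + 1))).filter fun p =>
      basicSol A b (T.basis p) ≠ basicSol A b (T.basis (p + 1))).card : ℝ) ≤
      (Pi.single j ε : Fin n → ℝ) ⬝ᵥ basicSol A b (T.basis (T.start (q + 1))) -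
        (Pi.single j ε : Fin n → ℝ) ⬝ᵥ basicSol A b (T.basis (T.start q)) := by
  have hfeas : ∀ p, p ≤ T.start (q + 1) → IsFeasibleBasis A b (T.basis p) := fun p hp =>
    h.isFeasibleBasis hB₀ (hp.trans (h.start_mono hq le_rfl))
  refine card_filter_Ico_le
    (g := fun p => (Pi.single j ε : Fin n → ℝ) ⬝ᵥ basicSol A b (T.basis p)) (h.start_le q hq) ?_ ?_
  · intro p hp hp' hne
    refine hP.add_one_le (basicSol_mem_extremePoints (hfeas p hp'.le))
      (basicSol_mem_extremePoints (hfeas (p + 1) hp')) hε ?_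
    obtain ⟨i, s, hs, hpos, hupd⟩ := himp p hp hp'
    rw [hupd] at hne ⊢
    exact dotProduct_lt_of_pivot (hfeas p hp'.le) hs hne hpos
  · intro p _ _ hne
    rw [not_not.mp hne]

/-- The sign in the objective puts the coordinate at least halfway to its target at the start, so it
can gain at most `k / 2` in steps of at least 1. -/
theorem card_nondegenerate_first_le [DecidablePred (NonconstantAt A b T)]
    [DecidablePred fun p => basicSol A b (T.basis p) ≠ basicSol A b (T.basis (p + 1))]
    (h : IsExecutionUpTo A b k c B₀ T N)
    (hP : IsZeroKLatticePolytope k (polyhedron A b)) (hB₀ : IsFeasibleBasis A b B₀)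
    (hN : N ≤ 2 * n) {q : ℕ} (hqn : q < n) (hq : q < N) :
    ((Finset.Ico (T.start q) (T.start (q + 1))).filter fun p =>
      basicSol A b (T.basis p) ≠ basicSol A b (T.basis (p + 1))).card ≤
        if NonconstantAt A b T q then k / 2 else 0 := by
  have hx := h.basicSol_mem_faceOf hB₀ hN hq le_rfl (h.start_le q hq)
  have hy := h.basicSol_mem_faceOf hB₀ hN hq (h.start_le q hq) le_rfl
  obtain ⟨j, -, -, hobj⟩ := h.obj_first q hqn hq
  have hcard := h.card_nondegenerate_le hP hB₀ hq (j := j)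
    (ε := if (k : ℝ) - basicSol A b (T.basis (T.start q)) j ≤
      basicSol A b (T.basis (T.start q)) j then 1 else -1) (by split_ifs <;> simp) (by
        intro p hp hp'
        obtain ⟨i, s, h1, h2⟩ := h.bland q hqn hq p hp hp'
        exact ⟨i, s, h1.1.2.2.1, hobj ▸ h1.1.2.1, h2⟩)
  by_cases hc : NonconstantAt A b T q
  -- Twice the count is compared with `k`, which yields the floor of the half.
  · rw [if_pos hc, Nat.le_div_iff_mul_le two_pos]
    rw [single_dotProduct, single_dotProduct] at hcard
    have h1 := hP.mem_box hx.1 j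
    have h2 := hP.mem_box hy.1 j
    rw [← Nat.cast_le (α := ℝ)]
    push_cast
    split_ifs at hcard <;> linarith
  · rw [if_neg hc]
    rw [← hobj] at hcard
    rw [h.face_eq hqn hq] at hx hy
    have heq : T.obj q ⬝ᵥ basicSol A b (T.basis (T.start (q + 1))) =
        T.obj q ⬝ᵥ basicSol A b (T.basis (T.start q)) := by
      by_contra hne
      exact hc ⟨_, hy, _, hx, hne⟩
    rw [heq, sub_self] at hcard
    exact_mod_cast hcard

/-- Progress is measured by the auxiliary vector `∓e_j`, not by `c`: every shadow pivot improves it,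
and its total range is `k`. -/
theorem card_nondegenerate_back_le [DecidablePred (NonconstantAt A b T)]
    [DecidablePred fun p => basicSol A b (T.basis p) ≠ basicSol A b (T.basis (p + 1))]
    (h : IsExecutionUpTo A b k c B₀ T N)
    (hP : IsZeroKLatticePolytope k (polyhedron A b)) (hB₀ : IsFeasibleBasis A b B₀)
    (hN : N ≤ 2 * n) {q : ℕ} (hqn : n ≤ q) (hq : q < N) :
    ((Finset.Ico (T.start q) (T.start (q + 1))).filter fun p =>
      basicSol A b (T.basis p) ≠ basicSol A b (T.basis (p + 1))).card ≤
        if NonconstantAt A b T (2 * n - 1 - q) then k else 0 := by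
  have hx := h.basicSol_mem_faceOf hB₀ hN hq le_rfl (h.start_le q hq)
  have hy := h.basicSol_mem_faceOf hB₀ hN hq (h.start_le q hq) le_rfl
  obtain ⟨j, ε, hε, hobj⟩ : ∃ (j : Fin n) (ε : ℝ), (ε = 1 ∨ ε = -1) ∧
      -T.obj (2 * n - 1 - q) = Pi.single j ε := by
    obtain ⟨j, -, -, hobj⟩ := h.obj_first (2 * n - 1 - q) (by omega) (by omega)
    rw [hobj, ← Pi.single_neg]
    exact ⟨j, _, by split_ifs <;> simp, rfl⟩
  have hcard := h.card_nondegenerate_le hP hB₀ hq hε (j := j) (by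
    intro p hp hp'
    obtain ⟨i, s, h1, h2⟩ := h.shadow q hqn hq p hp hp'
    exact ⟨i, s, h1.1.2.2.1, hobj ▸ h1.2.1, h2⟩)
  by_cases hc : NonconstantAt A b T (2 * n - 1 - q)
  · rw [if_pos hc]
    rw [single_dotProduct, single_dotProduct] at hcard
    have h1 := hP.mem_box hx.1 j
    have h2 := hP.mem_box hy.1 j
    rw [← Nat.cast_le (α := ℝ)]
    rcases hε with rfl | rfl <;> linarith
  · rw [if_neg hc]
    rw [← hobj] at hcard
    rw [h.face_back_eq hN hqn hq] at hx hy
    have heq : T.obj (2 * n - 1 - q) ⬝ᵥ basicSol A b (T.basis (T.start (q + 1))) =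
        T.obj (2 * n - 1 - q) ⬝ᵥ basicSol A b (T.basis (T.start q)) := by
      by_contra hne
      exact hc ⟨_, hy, _, hx, hne⟩
    rw [neg_dotProduct, neg_dotProduct, heq, sub_self] at hcard
    exact_mod_cast hcard

theorem card_filter_range_start (h : IsExecutionUpTo A b k c B₀ T N) (D : ℕ → Prop)
    [DecidablePred D] {q : ℕ}
    (hq : q ≤ N) :
    ((Finset.range (T.start q)).filter D).card =
      ∑ p ∈ Finset.range q, ((Finset.Ico (T.start p) (T.start (p + 1))).filter D).card := by
  induction q with
  | zero => simp [h.start_zero]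
  | succ q ih =>
    rw [Finset.sum_range_succ, ← ih (by omega), Finset.card_filter, Finset.card_filter,
      Finset.card_filter, Finset.range_eq_Ico, Finset.range_eq_Ico,
      Finset.sum_Ico_consecutive _ (Nat.zero_le _) (h.start_le q hq)]

theorem numNondegenerate_le (h : IsExecutionUpTo A b k c B₀ T (2 * n))
    (hP : IsZeroKLatticePolytope k (polyhedron A b)) (hB₀ : IsFeasibleBasis A b B₀) :
    T.numNondegenerate A b ≤
      Module.finrank ℝ (vectorSpan ℝ (polyhedron A b)) * (k + k / 2) := by
  classical
  have hd := h.card_nonconstant_add_finrank_le hB₀ le_rfl (q := n) le_rfl (by omega)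
  rw [SimplexTrace.numNondegenerate, SimplexTrace.numPivots, h.card_filter_range_start _ le_rfl,
    two_mul, Finset.sum_range_add]
  refine (add_le_add
    (Finset.sum_le_sum (g := fun q => if NonconstantAt A b T q then k / 2 else 0) fun q hq => ?_)
    (Finset.sum_le_sum (g := fun q => if NonconstantAt A b T (n - 1 - q) then k else 0)
      fun q hq => ?_)).trans ?_
  · have hq := Finset.mem_range.mp hq
    exact h.card_nondegenerate_first_le hP hB₀ le_rfl hq (by omega)
  · have hq := Finset.mem_range.mp hq
    have := h.card_nondegenerate_back_le hP hB₀ le_rfl (q := n + q) (by omega) (by omega)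
    rwa [show 2 * n - 1 - (n + q) = n - 1 - q by omega] at this
  -- The second half meets the same faces in reverse; after reflection both sums run over the same
  -- nonconstant objectives.
  · rw [Finset.sum_range_reflect (fun q => if NonconstantAt A b T q then k else 0),
      ← Finset.sum_filter, ← Finset.sum_filter, Finset.sum_const, Finset.sum_const, smul_eq_mul,
      smul_eq_mul, ← Nat.mul_add, add_comm (k / 2)]
    exact Nat.mul_le_mul_right _ ((Nat.le_add_right _ _).trans hd)

theorem exists_walk (h : IsExecutionUpTo A b k c B₀ T (2 * n)) (hB₀ : IsFeasibleBasis A b B₀) :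
    ∃ (u v : (polyhedron A b).extremePoints ℝ) (W : (polytopeGraph (polyhedron A b)).Walk u v),
      (u : Fin n → ℝ) = basicSol A b B₀ ∧ (v : Fin n → ℝ) = T.result A b ∧
      W.support.map Subtype.val = T.path A b ∧ W.length = T.numNondegenerate A b := by
  classical
  obtain ⟨u, v, W, hu, hv, hs, hl⟩ := exists_walk_destutter (P := polyhedron A b) T.numPivots
    (fun p => basicSol A b (T.basis p))
    (fun p hp => basicSol_mem_extremePoints (h.isFeasibleBasis hB₀ hp)) (by
      intro p hp
      obtain ⟨q, hq, hp1, hp2⟩ := h.exists_segment hp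
      obtain ⟨i, s, hpiv, hupd⟩ := h.pivot hq hp1 hp2
      simp only [hupd]
      exact hpiv.isExposed_segment (h.isFeasibleBasis hB₀ hp.le))
  refine ⟨u, v, W, by rw [hu, h.basis_zero], hv, ?_, ?_⟩
  · rw [hs, SimplexTrace.path]
  · rw [hl, SimplexTrace.numNondegenerate]

end IsExecutionUpTo

/-! ### Vertices of polyhedra -/

section Vertices

variable {m n : ℕ} {A : Matrix (Fin m) (Fin n) ℝ} {b : Fin m → ℝ} {u : Fin n → ℝ}

/-- For small ε both points u ± εy are feasible: tight rows do not see `y`, and the others have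
slack. Their midpoint is the extreme point `u`. -/
theorem eq_zero_of_tight_rows (hu : u ∈ (polyhedron A b).extremePoints ℝ) {y : Fin n → ℝ}
    (hy : ∀ r, A r ⬝ᵥ u = b r → A r ⬝ᵥ y = 0) : y = 0 := by
  have hev : ∀ᶠ ε : ℝ in nhdsWithin 0 (Set.Ioi 0), ∀ r, ε * |A r ⬝ᵥ y| ≤ b r - A r ⬝ᵥ u := by
    refine Filter.eventually_all.mpr fun r => ?_
    by_cases hr : A r ⬝ᵥ u = b r
    · simp [hy r hr, hr]
    · have hlt : 0 < b r - A r ⬝ᵥ u := sub_pos.mpr (lt_of_le_of_ne (hu.1 r) hr)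
      have ht : Filter.Tendsto (fun ε : ℝ => ε * |A r ⬝ᵥ y|) (nhdsWithin 0 (Set.Ioi 0))
          (nhds 0) := by
        have : Filter.Tendsto (fun ε : ℝ => ε * |A r ⬝ᵥ y|) (nhds 0) (nhds (0 * |A r ⬝ᵥ y|)) :=
          Filter.tendsto_id.mul_const _
        rw [zero_mul] at this
        exact this.mono_left nhdsWithin_le_nhds
      exact (ht.eventually_lt_const hlt).mono fun _ h => h.le
  obtain ⟨ε, hε, hpos⟩ := (hev.and self_mem_nhdsWithin).exists
  have hpos : 0 < ε := hpos
  have hmem : ∀ σ : ℝ, |σ| = 1 → u + (σ * ε) • y ∈ polyhedron A b := by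
    intro σ hσ r
    have h1 := hε r
    have h2 : σ * ε * (A r ⬝ᵥ y) ≤ ε * |A r ⬝ᵥ y| := by
      refine (le_abs_self _).trans (le_of_eq ?_)
      rw [abs_mul, abs_mul, hσ, one_mul, abs_of_pos hpos]
    rw [dotProduct_add, dotProduct_smul, smul_eq_mul]
    linarith
  have hseg : u ∈ openSegment ℝ (u + ((1 : ℝ) * ε) • y) (u + ((-1 : ℝ) * ε) • y) :=
    ⟨1 / 2, 1 / 2, by norm_num, by norm_num, by norm_num, by module⟩
  have h := hu.2 (hmem 1 (by simp)) (hmem (-1) (by simp)) hseg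
  rw [one_mul, add_eq_left, smul_eq_zero] at h
  exact h.resolve_left hpos.ne'

/-- Every vertex is the basic solution of a feasible basis. -/
theorem exists_feasibleBasis (hu : u ∈ (polyhedron A b).extremePoints ℝ) :
    ∃ B : Fin n → Fin m, IsFeasibleBasis A b B ∧ basicSol A b B = u := by
  let R : Set (Fin n → ℝ) := {a | ∃ r, A r ⬝ᵥ u = b r ∧ A r = a}
  -- If the tight rows did not span, a nonzero functional would vanish on all of them, against
  -- `eq_zero_of_tight_rows`. A basis is then extracted from them.
  have hspan : Submodule.span ℝ R = ⊤ := by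
    by_contra hne
    obtain ⟨f, hf, hle⟩ := Submodule.exists_le_ker_of_lt_top _ (lt_top_iff_ne_top.mpr hne)
    have hfdot : ∀ x, f x = x ⬝ᵥ fun j => f (Pi.single j 1) := by
      intro x
      conv_lhs => rw [pi_eq_sum_univ' x]
      simp [dotProduct, map_sum]
    refine hf (LinearMap.ext fun x => ?_)
    rw [hfdot, eq_zero_of_tight_rows hu (y := fun j => f (Pi.single j 1)), dotProduct_zero,
      LinearMap.zero_apply]
    intro r hr
    rw [← hfdot]
    exact hle (Submodule.subset_span ⟨r, hr, rfl⟩)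
  obtain ⟨S, hSR, hSspan, hli⟩ := exists_linearIndependent ℝ R
  rw [hspan] at hSspan
  let β := Module.Basis.mk hli (by rw [Subtype.range_coe, hSspan])
  have hfin : Finite S := Module.Finite.finite_basis β
  have hcard : Nat.card S = n := by
    rw [← Module.finrank_eq_nat_card_basis β]; simp
  let e : Fin n ≃ S := (Finite.equivFinOfCardEq hcard).symm
  choose B hB hBe using fun l => hSR (e l).2
  have hunit : IsUnit (A.submatrix B id).det := by
    refine isUnit_det_of_forall_eq_zero fun y hy => ?_
    have hall : ∀ x ∈ Submodule.span ℝ S, x ⬝ᵥ y = 0 := by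
      intro x hx
      induction hx using Submodule.span_induction with
      | mem x hx =>
        have := hy (e.symm ⟨x, hx⟩)
        rwa [hBe, Equiv.apply_symm_apply] at this
      | zero => exact zero_dotProduct y
      | add x z _ _ h1 h2 => rw [add_dotProduct, h1, h2, add_zero]
      | smul t x _ h => rw [smul_dotProduct, h, smul_zero]
    exact dotProduct_self_eq_zero.mp (hall y (by rw [hSspan]; trivial))
  have hsol : u = basicSol A b B := eq_basicSol hunit hB
  exact ⟨B, ⟨hunit, hsol ▸ hu.1⟩, hsol.symm⟩

/-- Every vertex is the unique maximizer of some objective. -/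
theorem exists_maximizers_eq_singleton (hu : u ∈ (polyhedron A b).extremePoints ℝ) :
    ∃ c, maximizers (polyhedron A b) c = {u} := by
  classical
  obtain ⟨B, hB, rfl⟩ := exists_feasibleBasis hu
  -- The sum of the basis rows is maximal exactly where all of them are tight, that is, at `u`
  -- alone.
  refine ⟨∑ r ∈ Finset.univ.image B, A r, ?_⟩
  rw [← faceOf_image_univ hB, faceOf_eq_maximizers]
  rw [faceOf_image_univ hB]
  exact Set.singleton_nonempty _

end Vertices

/-! ### Polytopes are polyhedra -/

section Weyl

variable {V : Type*} [AddCommGroup V] [Module ℝ V]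

/-- Fourier–Motzkin elimination of the coefficient of one generator of a cone. -/
theorem exists_finset_forall_le_zero_iff (s : Finset (V →ₗ[ℝ] ℝ)) (z : V) :
    ∃ s' : Finset (V →ₗ[ℝ] ℝ), ∀ y, (∀ f ∈ s', f y ≤ 0) ↔
      ∃ t : ℝ, 0 ≤ t ∧ ∀ f ∈ s, f (y - t • z) ≤ 0 := by
  classical
  -- Functionals that are nonpositive at `z` are kept; each pair of opposite signs at `z` gives the
  -- positive combination that vanishes there.
  refine ⟨s.filter (fun f => f z ≤ 0) ∪ ((s ×ˢ s).filter fun p => 0 < p.1 z ∧ p.2 z < 0).image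
    fun p => p.1 z • p.2 - p.2 z • p.1, fun y => ⟨fun h => ?_, ?_⟩⟩
  · have h1 : ∀ f ∈ s, f z ≤ 0 → f y ≤ 0 := fun f hf hfz =>
      h f (Finset.mem_union_left _ (Finset.mem_filter.mpr ⟨hf, hfz⟩))
    have h2 : ∀ f ∈ s, ∀ g ∈ s, 0 < f z → g z < 0 → f z * g y - g z * f y ≤ 0 :=
      fun f hf g hg hfz hgz => h _ (Finset.mem_union_right _ (Finset.mem_image.mpr
        ⟨(f, g), Finset.mem_filter.mpr ⟨Finset.mem_product.mpr ⟨hf, hg⟩, hfz, hgz⟩, rfl⟩))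
    -- The lower bounds on `t`: 0, and one for each functional positive at `z`. Their maximum serves
    -- as `t`, and the paired inequalities say that it respects the upper bounds.
    let U : Finset ℝ := insert 0 ((s.filter fun f => 0 < f z).image fun f => f y / f z)
    have hU : U.Nonempty := ⟨0, Finset.mem_insert_self _ _⟩
    refine ⟨U.max' hU, U.le_max' 0 (Finset.mem_insert_self _ _), fun f hf => ?_⟩
    rw [map_sub, map_smul, smul_eq_mul, sub_nonpos]
    rcases lt_trichotomy (f z) 0 with hfz | hfz | hfz
    · rcases Finset.mem_insert.mp (U.max'_mem hU) with h0 | hmem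
      · rw [h0, zero_mul]; exact h1 f hf hfz.le
      · obtain ⟨g, hg, hgU⟩ := Finset.mem_image.mp hmem
        obtain ⟨hgs, hgz⟩ := Finset.mem_filter.mp hg
        rw [← hgU, div_mul_eq_mul_div, le_div_iff₀ hgz]
        linarith [h2 g hgs f hf hgz hfz]
    · rw [hfz, mul_zero]; exact h1 f hf hfz.le
    · rw [← div_le_iff₀ hfz]
      exact U.le_max' _ (Finset.mem_insert_of_mem (Finset.mem_image.mpr
        ⟨f, Finset.mem_filter.mpr ⟨hf, hfz⟩, rfl⟩))
  · rintro ⟨t, ht, h⟩ f hf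
    simp only [map_sub, map_smul, smul_eq_mul, sub_nonpos] at h
    rcases Finset.mem_union.mp hf with hf | hf
    · obtain ⟨hfs, hfz⟩ := Finset.mem_filter.mp hf
      exact (h f hfs).trans (mul_nonpos_of_nonneg_of_nonpos ht hfz)
    · obtain ⟨⟨g, g'⟩, hg, rfl⟩ := Finset.mem_image.mp hf
      obtain ⟨hgs, hgz, hgz'⟩ := Finset.mem_filter.mp hg
      obtain ⟨h1, h2⟩ := Finset.mem_product.mp hgs
      have h3 := h g h1
      have h4 := h g' h2
      simp only at h3 h4 hgz hgz'
      simp only [LinearMap.sub_apply, LinearMap.smul_apply, smul_eq_mul]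
      nlinarith

/-- Finitely generated cones are polyhedral. -/
theorem exists_finset_mem_span_iff [FiniteDimensional ℝ V] (S : Finset V) :
    ∃ s : Finset (V →ₗ[ℝ] ℝ), ∀ y, y ∈ Submodule.span NNReal (S : Set V) ↔ ∀ f ∈ s, f y ≤ 0 := by
  classical
  induction S using Finset.induction_on with
  | empty =>
    let β := Module.finBasis ℝ V
    refine ⟨Finset.univ.image β.coord ∪ Finset.univ.image fun i => -β.coord i, fun y => ?_⟩
    rw [Finset.coe_empty, Submodule.span_empty, Submodule.mem_bot]
    constructor
    · rintro rfl f _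
      simp
    · intro h
      refine β.ext_elem_iff.mpr fun i => ?_
      have h1 := h (β.coord i) (Finset.mem_union_left _ (by simp))
      have h2 := h (-β.coord i) (Finset.mem_union_right _ (by simp))
      simp only [LinearMap.neg_apply, Module.Basis.coord_apply] at h1 h2
      simp only [map_zero, Finsupp.coe_zero, Pi.zero_apply]
      linarith
  | insert z S _ ih =>
    obtain ⟨s, hs⟩ := ih
    obtain ⟨s', hs'⟩ := exists_finset_forall_le_zero_iff s z
    refine ⟨s', fun y => ?_⟩
    rw [hs', Finset.coe_insert, Submodule.mem_span_insert]
    constructor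
    · rintro ⟨a, x, hx, rfl⟩
      refine ⟨a, a.2, ?_⟩
      rw [show a • z + x - (a : ℝ) • z = x by rw [NNReal.smul_def]; abel]
      exact (hs x).mp hx
    · rintro ⟨t, ht, h⟩
      refine ⟨t.toNNReal, y - t • z, (hs _).mpr h, ?_⟩
      rw [NNReal.smul_def, Real.coe_toNNReal t ht]; abel

open scoped Pointwise in
-- Homogenization: `S` is lifted to height 1. Each element of the cone over it is its height times a
-- point of the hull, so the slice at height 1 is the hull.
theorem mem_convexHull_iff_mem_span {S : Set V} (hS : S.Nonempty) (x : V) :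
    x ∈ convexHull ℝ S ↔
      (x, (1 : ℝ)) ∈ Submodule.span NNReal ((fun y => (y, (1 : ℝ))) '' S) := by
  constructor
  · intro hx
    let C : Set V := {x | (x, (1 : ℝ)) ∈ Submodule.span NNReal ((fun y => (y, (1 : ℝ))) '' S)}
    have hC : Convex ℝ C := by
      intro y hy z hz s t hs ht hst
      change (y, (1 : ℝ)) ∈ Submodule.span NNReal _ at hy
      change (z, (1 : ℝ)) ∈ Submodule.span NNReal _ at hz
      have h := add_mem (Submodule.smul_mem _ s.toNNReal hy)
        (Submodule.smul_mem _ t.toNNReal hz)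
      have heq : s.toNNReal • (y, (1 : ℝ)) + t.toNNReal • (z, (1 : ℝ)) =
          (s • y + t • z, (1 : ℝ)) := by
        ext <;> simp [NNReal.smul_def, hst, hs, ht]
      rwa [heq] at h
    exact convexHull_min (s := S) (t := C) (fun y hy => Submodule.subset_span ⟨y, hy, rfl⟩) hC hx
  · intro hx
    have hgen : ∀ p ∈ Submodule.span NNReal ((fun y => (y, (1 : ℝ))) '' S),
        0 ≤ p.2 ∧ ∃ y ∈ convexHull ℝ S, p.1 = p.2 • y := by
      intro p hp
      obtain ⟨y₀, hy₀⟩ := hS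
      induction hp using Submodule.span_induction with
      | mem p hp =>
        obtain ⟨y, hy, rfl⟩ := hp
        exact ⟨zero_le_one, y, subset_convexHull ℝ S hy, (one_smul ℝ y).symm⟩
      | zero => exact ⟨le_rfl, y₀, subset_convexHull ℝ S hy₀, (zero_smul ℝ y₀).symm⟩
      | add p q _ _ h1 h2 =>
        obtain ⟨hp, y, hy, hpy⟩ := h1
        obtain ⟨hq, z, hz, hqz⟩ := h2
        obtain ⟨x, hx, hxeq⟩ : ∃ x ∈ convexHull ℝ S, p.2 • y + q.2 • z = (p.2 + q.2) • x := by
          have hmem : p.2 • y + q.2 • z ∈ (p.2 + q.2) • convexHull ℝ S := by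
            rw [(convex_convexHull ℝ S).add_smul hp hq]
            exact Set.add_mem_add (Set.smul_mem_smul_set hy) (Set.smul_mem_smul_set hz)
          obtain ⟨x, hx, hxeq⟩ := hmem
          exact ⟨x, hx, hxeq.symm⟩
        exact ⟨add_nonneg hp hq, x, hx, by rw [Prod.fst_add, hpy, hqz, hxeq, Prod.snd_add]⟩
      | smul t p _ h =>
        obtain ⟨hp, y, hy, hpy⟩ := h
        exact ⟨mul_nonneg t.2 hp, y, hy, by
          rw [Prod.smul_fst, hpy, NNReal.smul_def, smul_smul]; rfl⟩
    obtain ⟨-, y, hy, hxy⟩ := hgen _ hx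
    simp only [one_smul] at hxy
    rwa [hxy]

/-- The convex hull of a nonempty finite set is a polyhedron. -/
theorem exists_polyhedron_eq_convexHull {n : ℕ} (S : Finset (Fin n → ℝ)) (hS : S.Nonempty) :
    ∃ (m : ℕ) (A : Matrix (Fin m) (Fin n) ℝ) (b : Fin m → ℝ),
      convexHull ℝ (S : Set (Fin n → ℝ)) = polyhedron A b := by
  classical
  obtain ⟨s, hs⟩ := exists_finset_mem_span_iff (S.image fun y => (y, (1 : ℝ)))
  let e := s.equivFin
  -- A homogeneous condition f(x, 1) ≤ 0 splits into f(x, 0) ≤ -f(0, 1), giving one row and its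
  -- right-hand side.
  refine ⟨s.card, fun r j => (e.symm r : ((Fin n → ℝ) × ℝ) →ₗ[ℝ] ℝ) (Pi.single j 1, 0),
    fun r => -(e.symm r : ((Fin n → ℝ) × ℝ) →ₗ[ℝ] ℝ) (0, 1), ?_⟩
  ext x
  rw [mem_convexHull_iff_mem_span (by simpa using hS), ← Finset.coe_image, hs]
  have hval : ∀ f : ((Fin n → ℝ) × ℝ) →ₗ[ℝ] ℝ,
      f (x, 1) = (fun j => f (Pi.single j 1, 0)) ⬝ᵥ x + f (0, 1) := by
    intro f
    have h1 : (x, (1 : ℝ)) = LinearMap.inl ℝ (Fin n → ℝ) ℝ x + (0, 1) := by simp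
    rw [h1, map_add]
    congr 1
    conv_lhs => rw [pi_eq_sum_univ' x]
    rw [map_sum, map_sum, dotProduct]
    refine Finset.sum_congr rfl fun j _ => ?_
    rw [map_smul, map_smul, smul_eq_mul, mul_comm]
    rfl
  constructor
  · intro h r
    have := h _ (e.symm r).2
    rw [hval] at this
    change _ ⬝ᵥ x ≤ _
    linarith
  · intro h f hf
    have := h (e ⟨f, hf⟩)
    simp only [Equiv.symm_apply_apply] at this
    rw [hval]
    linarith

end Weyl

theorem IsZeroKLatticePolytope.exists_polyhedron {n k : ℕ} {P : Set (Fin n → ℝ)}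
    (hP : IsZeroKLatticePolytope k P) :
    ∃ (m : ℕ) (A : Matrix (Fin m) (Fin n) ℝ) (b : Fin m → ℝ), P = polyhedron A b := by
  classical
  obtain ⟨S, hS, -, rfl⟩ := hP
  obtain ⟨m, A, b, h⟩ := exists_polyhedron_eq_convexHull
    (S.image fun (z : Fin n → ℤ) (j : Fin n) => (z j : ℝ)) (hS.image _)
  exact ⟨m, A, b, by rw [← h, Finset.coe_image]⟩

/-! ### The theorem -/

theorem polyhedron_simplex_execution {m n k : ℕ} {A : Matrix (Fin m) (Fin n) ℝ} {b : Fin m → ℝ}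
    {c : Fin n → ℝ} {B₀ : Fin n → Fin m} (hB₀ : IsFeasibleBasis A b B₀) {T : SimplexTrace m n}
    (hT : IsExecution A b k c B₀ T) :
    (∀ q, q < 2 * n → IsExposed ℝ (polyhedron A b) (faceOf A b (T.face q)) ∧
      basicSol A b (T.basis (T.start (q + 1))) ∈
        maximizers (faceOf A b (T.face q)) (T.obj q)) ∧
    (∀ q, q + 1 < n →
      faceOf A b (T.face (q + 1)) = maximizers (faceOf A b (T.face q)) (T.obj q)) := by
  have h := isExecution_iff.mp hT
  refine ⟨fun q hq => ⟨isExposed_faceOf, h.basicSol_mem_maximizers hB₀ le_rfl hq⟩, fun q hq => ?_⟩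
  rw [h.face_eq hq (by omega), h.face_eq (by omega) (by omega)]
  exact h.faceOf_traceFace_succ hB₀ le_rfl (by omega) (by omega)

theorem theorem1p6 (n k d : ℕ) (P : Set (Fin n → ℝ)) (hP : IsZeroKLatticePolytope k P)
    (hd : Module.finrank ℝ (vectorSpan ℝ P) = d) :
    (∀ (m : ℕ) (A : Matrix (Fin m) (Fin n) ℝ) (b : Fin m → ℝ), P = polyhedron A b →
      (∀ (c : Fin n → ℝ) (B₀ : Fin n → Fin m), IsFeasibleBasis A b B₀ →
        (∃ T : SimplexTrace m n, IsExecution A b k c B₀ T) ∧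
        ∀ T : SimplexTrace m n, IsExecution A b k c B₀ T →
          (∀ q, q < 2 * n → IsExposed ℝ P (faceOf A b (T.face q)) ∧
            basicSol A b (T.basis (T.start (q + 1))) ∈
              maximizers (faceOf A b (T.face q)) (T.obj q)) ∧
          (∀ q, q + 1 < n →
            faceOf A b (T.face (q + 1)) = maximizers (faceOf A b (T.face q)) (T.obj q)) ∧
          T.result A b ∈ maximizers P c ∧
          T.numNondegenerate A b ≤ d * (k + k / 2) ∧
          ∃ (u v : P.extremePoints ℝ) (W : (polytopeGraph P).Walk u v),
            (u : Fin n → ℝ) = basicSol A b B₀ ∧ (v : Fin n → ℝ) = T.result A b ∧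
            W.support.map Subtype.val = T.path A b ∧ W.length = T.numNondegenerate A b) ∧
      (∀ u ∈ P.extremePoints ℝ, ∀ v ∈ P.extremePoints ℝ,
        ∃ (c : Fin n → ℝ) (B₀ : Fin n → Fin m), IsFeasibleBasis A b B₀ ∧ basicSol A b B₀ = u ∧
          ∀ T : SimplexTrace m n, IsExecution A b k c B₀ T → T.result A b = v)) ∧
    (polytopeGraph P).ediam ≤ ((d * (k + k / 2) : ℕ) : ℕ∞) := by
  have hmain : ∀ (m : ℕ) (A : Matrix (Fin m) (Fin n) ℝ) (b : Fin m → ℝ), P = polyhedron A b →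
      ∀ u ∈ P.extremePoints ℝ, ∀ v ∈ P.extremePoints ℝ,
        ∃ (c : Fin n → ℝ) (B₀ : Fin n → Fin m), IsFeasibleBasis A b B₀ ∧ basicSol A b B₀ = u ∧
          ∀ T : SimplexTrace m n, IsExecution A b k c B₀ T → T.result A b = v := by
    rintro m A b rfl u hu v hv
    obtain ⟨B₀, hB₀, hsol⟩ := exists_feasibleBasis hu
    -- As `v` is the only maximizer of `c`, every execution must end there, whatever pivots it
    -- makes.
    obtain ⟨c, hc⟩ := exists_maximizers_eq_singleton hv
    refine ⟨c, B₀, hB₀, hsol, fun T hT => ?_⟩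
    have := (isExecution_iff.mp hT).result_mem_maximizers hB₀
    rwa [hc] at this
  refine ⟨fun m A b hPA => ⟨fun c B₀ hB₀ => ?_, hmain m A b hPA⟩, ?_⟩
  · subst hPA
    obtain ⟨T, hT⟩ := exists_isExecutionUpTo k c hB₀ hP.isBounded (2 * n) le_rfl
    refine ⟨⟨T, isExecution_iff.mpr hT⟩, fun T hT => ?_⟩
    have h := isExecution_iff.mp hT
    obtain ⟨hopt, hface⟩ := polyhedron_simplex_execution hB₀ hT
    exact ⟨hopt, hface, h.result_mem_maximizers hB₀, hd ▸ h.numNondegenerate_le hP hB₀,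
      h.exists_walk hB₀⟩
  -- Any description of P by inequalities will do: the walk recorded by an execution from `u` to `v`
  -- bounds their distance.
  · obtain ⟨m, A, b, hPA⟩ := hP.exists_polyhedron
    refine SimpleGraph.ediam_le_of_edist_le fun u v => ?_
    obtain ⟨c, B₀, hB₀, hu, hv⟩ := hmain m A b hPA u u.2 v v.2
    subst hPA
    obtain ⟨T, hT⟩ := exists_isExecutionUpTo k c hB₀ hP.isBounded (2 * n) le_rfl
    obtain ⟨u', v', W, hu', hv', -, hlen⟩ := hT.exists_walk hB₀
    obtain rfl : u' = u := Subtype.ext (hu'.trans hu)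
    obtain rfl : v' = v := Subtype.ext (hv'.trans (hv T (isExecution_iff.mpr hT)))
    refine W.edist_le.trans ?_
    rw [hlen]
    exact_mod_cast hd ▸ hT.numNondegenerate_le hP hB₀
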